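/- Let $d\ge 2$, $1\le m<d$ and $n\ge 1$ be integers, and let $\nu\ge 0$, $c>0$, $t>0$ be real. Let $\underline\theta_k=(\theta_{1,k},\dots,\theta_{d-2,k},\phi_k)$, $1\le k\le n+1$, be independent random vectors, each with density $$\frac{\Gamma(\nu+\frac d2)}{2\pi^{\frac{d-1}2}\Gamma(\nu+\frac12)}\,\sin^{2\nu+d-2}\theta_1\,\sin^{2\nu+d-3}\theta_2\cdots\sin^{2\nu+1}\theta_{d-2}\,|\sin\phi|^{2\nu},\qquad \theta_1,\dots,\theta_{d-2}\in[0,\pi],\ \phi\in[0,2\pi].$$ Let $(\tau_1,\dots,\tau_n)$ be a random vector independent of $(\underline\theta_1,\dots,\underline\theta_{n+1})$ with the rescaled Dirichlet density $$\frac{\Gamma((n+1)(2\nu+d-1))}{\Gamma(2\nu+d-1)^{n+1}}\,\frac{\prod_{k=1}^{n+1}\tau_k^{2\nu+d-2}}{t^{(n+1)(2\nu+d-1)-1}},\qquad \tau_1,\dots,\tau_n>0,\ \ \tau_1+\dots+\tau_n<t,$$ where $\tau_{n+1}=t-\tau_1-\dots-\tau_n$. Let $v_k\in\mathbb R^d$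 be the unit vector with hyperspherical coordinates $\underline\theta_k$, that is, $v_k=(\cos\theta_{1,k},\ \sin\theta_{1,k}\cos\theta_{2,k},\ \dots,\ \sin\theta_{1,k}\cdots\sin\theta_{d-2,k}\cos\phi_k,\ \sin\theta_{1,k}\cdots\sin\theta_{d-2,k}\sin\phi_k)$. Let $\underline{\mathbf X}_d(t)=c\sum_{k=1}^{n+1}\tau_k v_k$ be the position at time $t$ of the random flight with speed $c$ and $n$ changes of direction, and let $\underline{\mathbf X}^d_m(t)\in\mathbb R^m$ consist of its first $m$ coordinates. Put $\mu=\frac{(n+1)(2\nu+d-1)}2-\frac12$. Then the law of $\underline{\mathbf X}^d_m(t)$ is absolutely continuous with respect to Lebesgue measure on $\mathbb R^m$ and is concentrated on the open ball $\{x\in\mathbb R^m:\|x\|<ct\}$, where its density is $$\frac{\Gamma(\mu+1)}{\Gamma(\mu+1-\frac m2)\,\pi^{m/2}\,(ct)^{2\mu}}\,\bigl(c^2t^2-\|x\|^2\bigr)^{\mu-\frac m2}.$$ In particular the law is isotropic: it is invariant under every linear isometry of $\mathbb R^m$. -/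

import Mathlib

open MeasureTheory ProbabilityTheory

noncomputable section

namespace RandomFlight

/-- The unit vector of `ℝ^d` with hyperspherical coordinates `θ = (θ₁, …, θ_{d-2}, φ)`
(with `φ = θ_{d-1}`; the Lean indices start at `0`):
`x₁ = cos θ₁`, `x₂ = sin θ₁ cos θ₂`, …, `x_{d-1} = sin θ₁ ⋯ sin θ_{d-2} cos φ`,
`x_d = sin θ₁ ⋯ sin θ_{d-2} sin φ`. -/
def direction (d : ℕ) (θ : Fin (d - 1) → ℝ) : EuclideanSpace ℝ (Fin d) :=
  WithLp.toLp 2 fun i : Fin d =>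
    (∏ j : Fin (d - 1), if j.val < i.val then Real.sin (θ j) else 1) *
      (if h : i.val < d - 1 then Real.cos (θ ⟨i.val, h⟩) else 1)

/-- The range of the hyperspherical coordinates: `[0, π]` for `θ₁, …, θ_{d-2}` and `[0, 2π]` for
the last angle `φ`. -/
def angleBox (d : ℕ) : Set (Fin (d - 1) → ℝ) :=
  {θ | ∀ j : Fin (d - 1),
    θ j ∈ Set.Icc 0 (if j.val + 1 = d - 1 then 2 * Real.pi else Real.pi)}

/-- The density `g_{d,ν}` of the angles on `angleBox d`:
`Γ(ν + d/2) / (2 π^{(d-1)/2} Γ(ν + 1/2)) · sin^{2ν+d-2} θ₁ ⋯ sin^{2ν+1} θ_{d-2} · sin^{2ν} φ`.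
The sine is nonnegative on `[0, π]`; for the last angle `sin^{2ν} φ` means `(sin² φ)^ν`, that is
`|sin φ|^{2ν}`. -/
def angleDensity (d : ℕ) (ν : ℝ) (θ : Fin (d - 1) → ℝ) : ℝ :=
  Real.Gamma (ν + d / 2) / (2 * Real.pi ^ (((d : ℝ) - 1) / 2) * Real.Gamma (ν + 1 / 2)) *
    ∏ j : Fin (d - 1), |Real.sin (θ j)| ^ (2 * ν + d - 2 - (j.val : ℝ))

/-- The law of the angles of one direction. -/
def angleLaw (d : ℕ) (ν : ℝ) : Measure (Fin (d - 1) → ℝ) :=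
  (volume.restrict (angleBox d)).withDensity fun θ => ENNReal.ofReal (angleDensity d ν θ)

/-- All `n + 1` time lengths `τ₁, …, τ_n, τ_{n+1}`, where `τ_{n+1} = t - (τ₁ + ⋯ + τ_n)`. -/
def durations {n : ℕ} (t : ℝ) (τ : Fin n → ℝ) : Fin (n + 1) → ℝ :=
  Fin.snoc (α := fun _ => ℝ) τ (t - ∑ j, τ j)

/-- The open simplex in which `(τ₁, …, τ_n)` takes its values. -/
def timeSimplex (n : ℕ) (t : ℝ) : Set (Fin n → ℝ) :=
  {τ | (∀ j, 0 < τ j) ∧ ∑ j, τ j < t}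

/-- The rescaled Dirichlet density `f_{d,ν}` of `(τ₁, …, τ_n)` on the simplex, all of whose `n + 1`
parameters are `2ν + d - 1`. -/
def timeDensity (d n : ℕ) (ν t : ℝ) (τ : Fin n → ℝ) : ℝ :=
  Real.Gamma (((n : ℝ) + 1) * (2 * ν + d - 1)) / Real.Gamma (2 * ν + d - 1) ^ (n + 1) *
    ((∏ k, durations t τ k ^ (2 * ν + d - 2)) /
      t ^ (((n : ℝ) + 1) * (2 * ν + d - 1) - 1))

/-- The law of `(τ₁, …, τ_n)`. -/
def timeLaw (d n : ℕ) (ν t : ℝ) : Measure (Fin n → ℝ) :=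
  (volume.restrict (timeSimplex n t)).withDensity fun τ =>
    ENNReal.ofReal (timeDensity d n ν t τ)

/-- The random data of a flight in `ℝ^d` on the time interval `[0, t]` with `n` changes of
direction and parameter `ν`: the time lengths `τ = (τ₁, …, τ_n)` have the rescaled Dirichlet law,
the angles `θ k` of each of the `n + 1` directions have density `g_{d,ν}`, the directions are
independent of each other, and together they are independent of the time lengths. -/
structure IsFlightData {Ω : Type*} [MeasurableSpace Ω] (P : Measure Ω) (d n : ℕ) (ν t : ℝ)
    (τ : Ω → Fin n → ℝ) (θ : Fin (n + 1) → Ω → Fin (d - 1) → ℝ) : Prop where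
  time_law : HasLaw τ (timeLaw d n ν t) P
  angle_law : ∀ k, HasLaw (θ k) (angleLaw d ν) P
  angle_indep : iIndepFun θ P
  time_angle_indep : IndepFun τ (fun ω k => θ k ω) P

/-- The position at time `t` of the particle moving with speed `c` from the origin, for the time
lengths `τ` and the angles `θ 0, …, θ n`. -/
def position (d : ℕ) {n : ℕ} (c t : ℝ) (τ : Fin n → ℝ) (θ : Fin (n + 1) → Fin (d - 1) → ℝ) :
    EuclideanSpace ℝ (Fin d) :=
  c • ∑ k, durations t τ k • direction d (θ k)

/-- The projection `(x₁, …, x_d) ↦ (x₁, …, x_m)` of `ℝ^d` onto `ℝ^m`. -/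
def proj {m d : ℕ} (h : m ≤ d) (x : EuclideanSpace ℝ (Fin d)) : EuclideanSpace ℝ (Fin m) :=
  WithLp.toLp 2 fun i => x (Fin.castLE h i)

/-- The position at time `t` of the projected flight `X_m^d`, as a random vector in `ℝ^m`. -/
def projectedFlight {Ω : Type*} {m d n : ℕ} (h : m ≤ d) (c t : ℝ)
    (τ : Ω → Fin n → ℝ) (θ : Fin (n + 1) → Ω → Fin (d - 1) → ℝ) (ω : Ω) :
    EuclideanSpace ℝ (Fin m) :=
  proj h (position d c t (τ ω) fun k => θ k ω)

end RandomFlight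

end

/-! The law is identified through the transform `s ↦ E (1 - ⟪s, Y⟫) ^ (-A)`, `‖s‖ < 1`, of the
rescaled position `Y = X / (c t)`, with the single exponent `A = (n + 1) a`, `a = 2ν + d - 1`. For a
measure carried by the closed unit ball this transform determines all moments of all linear forms,
hence the measure (`ext_of_lintegral_one_sub_inner_rpow`).

Since the durations add up to `t`, `1 - ⟪s, Y⟫` is the average of the numbers `x k = 1 - ⟪s, v k⟫`
with weights `τ k / t`. The Dirichlet mean of the power `-(n + 1) a` of such an average is `∏ x k ^
(-a)` (`lintegral_timeSimplex_prod_mul_rpow`), so independence of the directions turns the transform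
into a product of one-direction means.

The law of a direction need not be isotropic in `ℝ^d`, but for `s` orthogonal to the last axis,
which is what `m < d` provides, `⟪s, v⟫` is distributed as `‖s‖ y` with `y` of density proportional
to `(1 - y²) ^ (a / 2 - 1)` on `(-1, 1)` (`exists_lintegral_angularForm`). A Möbius substitution
evaluates the mean of `(1 - ‖s‖ y) ^ (-a)` for this law as `(1 - ‖s‖²) ^ (-a / 2)`
(`lintegral_one_sub_sq_mul_one_sub_rpow`). The transform of `Y` is therefore `(1 - ‖s‖²) ^ (-A /
2)`.

The ball law with exponent `μ - m / 2` has one-dimensional marginals with weight `(1 - y²) ^ (A / 2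
- 1)`, because `A = 2μ + 1`. The same Möbius lemma gives it the same transform
(`lintegral_ballLaw_rpow`). -/

noncomputable section

namespace RandomFlight

/-! ### Measures on the unit ball are determined by a negative-power transform. -/

section Determinacy

open scoped RealInnerProductSpace

/-- Termwise integration of a power series in a function bounded by one. -/
theorem hasSum_mul_integral_pow {X : Type*} [MeasurableSpace X] {κ : Measure X}
    [IsFiniteMeasure κ] {f : X → ℝ} (hf : Measurable f) (hb : ∀ᵐ x ∂κ, |f x| ≤ 1)
    {a : ℕ → ℂ} (ha : Summable fun k => ‖a k‖) {g : X → ℂ}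
    (hg : ∀ᵐ x ∂κ, HasSum (fun k => a k * (f x : ℂ) ^ k) (g x)) :
    HasSum (fun k => a k * ((∫ x, f x ^ k ∂κ : ℝ) : ℂ)) (∫ x, g x ∂κ) := by
  have hbound : ∀ k, ∀ᵐ x ∂κ, ‖a k * (f x : ℂ) ^ k‖ ≤ ‖a k‖ := by
    intro k
    filter_upwards [hb] with x hx
    rw [norm_mul, norm_pow, Complex.norm_real, Real.norm_eq_abs]
    exact mul_le_of_le_one_right (norm_nonneg _) (pow_le_one₀ (abs_nonneg _) hx)
  have hmeas : ∀ k, AEStronglyMeasurable (fun x => a k * (f x : ℂ) ^ k) κ := fun k =>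
    (by fun_prop : Measurable fun x => a k * (f x : ℂ) ^ k).aestronglyMeasurable
  have h := hasSum_integral_of_dominated_convergence (μ := κ) (bound := fun k _ => ‖a k‖) hmeas
    hbound (Filter.Eventually.of_forall fun _ => ha) (integrable_const _) hg
  refine Eq.mp (congrArg (HasSum · _) (funext fun k => ?_)) h
  rw [integral_const_mul, ← integral_complex_ofReal]
  simp

theorem hasSum_lintegral_one_sub_rpow {X : Type*} [MeasurableSpace X] {κ : Measure X}
    [IsFiniteMeasure κ] {f : X → ℝ} (hf : Measurable f) (hb : ∀ᵐ x ∂κ, |f x| ≤ 1) (A : ℝ)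
    {r : ℝ} (hr : |r| < 1) :
    HasSum (fun k => r ^ k * ((-1) ^ k * Ring.choose (-A) k * ∫ x, f x ^ k ∂κ))
      (∫⁻ x, ENNReal.ofReal ((1 - r * f x) ^ (-A)) ∂κ).toReal := by
  have hsum : ∀ z : ℝ, |z| < 1 → HasSum (fun k => Ring.choose (-A) k * z ^ k) ((1 + z) ^ (-A)) := by
    intro z hz
    have := (Real.one_add_rpow_hasFPowerSeriesOnBall_zero (a := -A)).hasSum (y := z)
      (by simpa [enorm_eq_nnnorm, ← NNReal.coe_lt_coe] using hz)
    simpa [binomialSeries_apply, -FormalMultilinearSeries.apply_eq_prod_smul_coeff] using this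
  have habs : Summable fun k => ‖((Ring.choose (-A) k * (-r) ^ k : ℝ) : ℂ)‖ := by
    have := (hsum (-r) (by simpa using hr)).summable.norm
    simpa using this
  have hlt : ∀ᵐ x ∂κ, |(-r) * f x| < 1 := by
    filter_upwards [hb] with x hx
    rw [abs_mul, abs_neg]
    exact mul_lt_one_of_nonneg_of_lt_one_left (abs_nonneg _) hr hx
  have h := hasSum_mul_integral_pow hf hb habs (g := fun x => (((1 - r * f x) ^ (-A) : ℝ) : ℂ)) (by
    filter_upwards [hlt] with x hx
    have := Complex.hasSum_ofReal.2 (hsum _ hx)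
    rw [show 1 + -r * f x = 1 - r * f x by ring] at this
    refine Eq.mp (congrArg (HasSum · _) (funext fun k => ?_)) this
    push_cast
    rw [mul_pow]
    ring)
  rw [integral_complex_ofReal] at h
  simp only [← Complex.ofReal_mul] at h
  have h' := Complex.hasSum_ofReal.1 h
  rw [integral_eq_lintegral_of_nonneg_ae] at h'
  · refine Eq.mp (congrArg (HasSum · _) (funext fun k => ?_)) h'
    rw [neg_pow]
    ring
  · filter_upwards [hlt] with x hx
    exact Real.rpow_nonneg (by have := (abs_lt.1 hx).1; linarith) _
  · exact Measurable.aestronglyMeasurable (by fun_prop)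

/-- Up to the factor `(-1) ^ k * k!` the coefficient is the rising factorial of `A > 0`. No moment
is thus lost in the binomial expansion of the transform. -/
theorem choose_neg_ne_zero {A : ℝ} (hA : 0 < A) (k : ℕ) : Ring.choose (-A) k ≠ 0 := by
  intro h
  have h1 := Polynomial.ascPochhammer_smeval_neg_eq_descPochhammer (-A) k
  rw [Ring.descPochhammer_eq_factorial_smul_choose, h, smul_zero, smul_zero, neg_neg,
    Polynomial.ascPochhammer_smeval_eq_eval] at h1
  exact (ascPochhammer_pos k A hA).ne' h1

/-- Along a ray `s = r u` the transform is a power series in `r` whose coefficients are nonzero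
multiples of the moments of `⟪u, x⟫`. Equal transforms give equal moments, and on a bounded set
these sum to the characteristic function. -/
theorem ext_of_lintegral_one_sub_inner_rpow {E : Type*} [NormedAddCommGroup E]
    [InnerProductSpace ℝ E] [MeasurableSpace E] [BorelSpace E] [CompleteSpace E]
    [SecondCountableTopology E] {κ ρ : Measure E} [IsFiniteMeasure κ] [IsFiniteMeasure ρ]
    (hκ : ∀ᵐ x ∂κ, ‖x‖ ≤ 1) (hρ : ∀ᵐ x ∂ρ, ‖x‖ ≤ 1) {A : ℝ} (hA : 0 < A)
    (h : ∀ s : E, ‖s‖ < 1 → ∫⁻ x, ENNReal.ofReal ((1 - ⟪s, x⟫) ^ (-A)) ∂κ =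
      ∫⁻ x, ENNReal.ofReal ((1 - ⟪s, x⟫) ^ (-A)) ∂ρ) : κ = ρ := by
  have hinner : ∀ {κ : Measure E}, (∀ᵐ x ∂κ, ‖x‖ ≤ 1) → ∀ u : E, ‖u‖ ≤ 1 →
      ∀ᵐ x ∂κ, |⟪u, x⟫| ≤ 1 := by
    intro κ hκ u hu
    filter_upwards [hκ] with x hx
    exact (abs_real_inner_le_norm u x).trans (mul_le_one₀ hu (norm_nonneg _) hx)
  have hm : ∀ u : E, Measurable fun x => ⟪u, x⟫ := fun u => by fun_prop
  have hmom : ∀ u : E, ‖u‖ ≤ 1 → ∀ k : ℕ, ∫ x, ⟪u, x⟫ ^ k ∂κ = ∫ x, ⟪u, x⟫ ^ k ∂ρ := by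
    intro u hu
    -- `F` has one expansion at `0` with the moments of `κ` and another with those of `ρ`;
    -- uniqueness of power series identifies them.
    set F : ℝ → ℝ := fun r => (∫⁻ x, ENNReal.ofReal ((1 - r * ⟪u, x⟫) ^ (-A)) ∂κ).toReal
    have key : ∀ (κ' : Measure E) [IsFiniteMeasure κ'], (∀ᵐ x ∂κ', ‖x‖ ≤ 1) →
        (∀ r : ℝ, |r| < 1 →
          F r = (∫⁻ x, ENNReal.ofReal ((1 - r * ⟪u, x⟫) ^ (-A)) ∂κ').toReal) →
        HasFPowerSeriesAt F (FormalMultilinearSeries.ofScalars ℝ fun k =>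
          (-1) ^ k * Ring.choose (-A) k * ∫ x, ⟪u, x⟫ ^ k ∂κ') 0 := by
      intro κ' _ hκ' hF
      rw [hasFPowerSeriesAt_iff]
      filter_upwards [Metric.ball_mem_nhds (0 : ℝ) one_pos] with r hr
      have hr : |r| < 1 := by simpa using hr
      rw [zero_add, hF r hr]
      simpa [FormalMultilinearSeries.coeff_ofScalars] using
        hasSum_lintegral_one_sub_rpow (hm u) (hinner hκ' u hu) A hr
    have e1 := key κ hκ fun r _ => rfl
    have e2 := key ρ hρ fun r hr => by
      have hs : ‖r • u‖ < 1 := by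
        rw [norm_smul]
        exact mul_lt_one_of_nonneg_of_lt_one_left (norm_nonneg _) hr hu
      have := h (r • u) hs
      simp only [real_inner_smul_left] at this
      simp only [F, this]
    intro k
    have := congrArg (fun p => FormalMultilinearSeries.coeff p k)
      (e1.eq_formalMultilinearSeries e2)
    simp only [FormalMultilinearSeries.coeff_ofScalars] at this
    exact mul_left_cancel₀ (mul_ne_zero (by simp) (choose_neg_ne_zero hA k)) this
  refine Measure.ext_of_charFun (funext fun w => ?_)
  have key : ∀ (κ' : Measure E) [IsFiniteMeasure κ'], (∀ᵐ x ∂κ', ‖x‖ ≤ 1) →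
      HasSum (fun k => (‖w‖ * Complex.I) ^ k / (k.factorial : ℂ) *
        ((∫ x, ⟪‖w‖⁻¹ • w, x⟫ ^ k ∂κ' : ℝ) : ℂ)) (charFun κ' w) := by
    intro κ' _ hκ'
    -- For `w = 0` the normalized vector is `0`, since `0⁻¹ = 0`; hence an inequality, which is all
    -- the moment identity requires.
    have hu : ‖‖w‖⁻¹ • w‖ ≤ 1 := by
      rw [norm_smul, norm_inv, norm_norm]
      exact inv_mul_le_one
    refine hasSum_mul_integral_pow (hm _) (hinner hκ' _ hu) ?_ ?_
    · exact (NormedSpace.expSeries_div_summable (‖w‖ * Complex.I)).norm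
    · refine Filter.Eventually.of_forall fun x => ?_
      have := NormedSpace.expSeries_div_hasSum_exp (⟪x, w⟫ * Complex.I : ℂ)
      rw [← Complex.exp_eq_exp_ℂ] at this
      refine Eq.mp (congrArg (HasSum · _) (funext fun k => ?_)) this
      rw [div_mul_eq_mul_div, ← mul_pow]
      congr 2
      have : ⟪x, w⟫ = ‖w‖ * ⟪‖w‖⁻¹ • w, x⟫ := by
        rcases eq_or_ne w 0 with rfl | hw
        · simp
        · rw [real_inner_smul_left, mul_inv_cancel_left₀ (norm_ne_zero_iff.2 hw), real_inner_comm]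
      rw [this]; push_cast; ring
  have h1 := key κ hκ
  have h2 := key ρ hρ
  simp only [hmom _ (by rw [norm_smul, norm_inv, norm_norm]; exact inv_mul_le_one :
    ‖‖w‖⁻¹ • w‖ ≤ 1)] at h1
  exact h1.unique h2

end Determinacy

/-! ### The Möbius substitution for symmetric beta weights. -/

section OneDimensional

open Set

/-- The Möbius transformation `z ↦ (z + s) / (1 + s z)` of `(-1, 1)`. -/
def mobius (s z : ℝ) : ℝ := (z + s) / (1 + s * z)

theorem one_add_mul_pos {s z : ℝ} (hs : |s| < 1) (hz : |z| < 1) : 0 < 1 + s * z := by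
  have : |s * z| < 1 := by
    rw [abs_mul]
    exact mul_lt_one_of_nonneg_of_lt_one_left (abs_nonneg _) hs hz.le
  linarith [(abs_lt.1 this).1]

theorem one_sub_mobius_sq {s z : ℝ} (h : 1 + s * z ≠ 0) :
    1 - mobius s z ^ 2 = (1 - s ^ 2) * (1 - z ^ 2) / (1 + s * z) ^ 2 := by
  have h2 : (1 + s * z) ^ 2 ≠ 0 := pow_ne_zero 2 h
  rw [mobius, div_pow, eq_div_iff h2, sub_mul, div_mul_cancel₀ _ h2]
  ring

theorem one_sub_mul_mobius {s z : ℝ} (h : 1 + s * z ≠ 0) :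
    1 - s * mobius s z = (1 - s ^ 2) / (1 + s * z) := by
  rw [mobius, eq_div_iff h, sub_mul, mul_assoc, div_mul_cancel₀ _ h]
  ring

theorem one_sub_sq_pos {s : ℝ} (hs : |s| < 1) : 0 < 1 - s ^ 2 := by
  have := (sq_lt_one_iff_abs_lt_one s).2 hs
  linarith

theorem abs_mobius_lt_one {s z : ℝ} (hs : |s| < 1) (hz : |z| < 1) : |mobius s z| < 1 := by
  have h := one_add_mul_pos hs hz
  have h1 := one_sub_mobius_sq h.ne'
  have h2 : 0 < 1 - mobius s z ^ 2 := by
    rw [h1]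
    have := one_sub_sq_pos hs
    have := one_sub_sq_pos hz
    positivity
  exact (sq_lt_one_iff_abs_lt_one _).1 (by linarith)

theorem mobius_neg_mobius {s z : ℝ} (hs : |s| < 1) (hz : |z| < 1) :
    mobius (-s) (mobius s z) = z := by
  have h := one_add_mul_pos hs hz
  have h2 := one_sub_sq_pos hs
  rw [mobius, neg_mul, ← sub_eq_add_neg, ← sub_eq_add_neg, one_sub_mul_mobius h.ne', mobius,
    div_eq_iff (div_pos h2 h).ne', mul_div_assoc', eq_div_iff h.ne', sub_mul, div_mul_cancel₀ _ h.ne']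
  ring

theorem mem_Ioo_neg_one_one {z : ℝ} : z ∈ Ioo (-1 : ℝ) 1 ↔ |z| < 1 := by
  rw [mem_Ioo, abs_lt]

theorem mobius_image {s : ℝ} (hs : |s| < 1) : mobius s '' Ioo (-1) 1 = Ioo (-1) 1 := by
  ext y
  simp only [mem_image, mem_Ioo_neg_one_one]
  constructor
  · rintro ⟨z, hz, rfl⟩
    exact abs_mobius_lt_one hs hz
  · intro hy
    have hs' : |-s| < 1 := by rwa [abs_neg]
    exact ⟨mobius (-s) y, abs_mobius_lt_one hs' hy, by simpa using mobius_neg_mobius hs' hy⟩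

theorem hasDerivAt_mobius {s z : ℝ} (h : 1 + s * z ≠ 0) :
    HasDerivAt (mobius s) ((1 - s ^ 2) / (1 + s * z) ^ 2) z := by
  have h1 : HasDerivAt (fun z => z + s) 1 z := (hasDerivAt_id z).add_const s
  have h2 : HasDerivAt (fun z => 1 + s * z) s z := by
    simpa using ((hasDerivAt_id z).const_mul s).const_add 1
  convert! h1.div h2 h using 1
  ring

/-- The mean of `(1 - s y)^(-a)` for the symmetric beta weight `(1 - y²)^(a/2 - 1)`. -/
theorem lintegral_one_sub_sq_mul_one_sub_rpow (a : ℝ) {s : ℝ} (hs : |s| < 1) :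
    ∫⁻ y in Ioo (-1 : ℝ) 1, ENNReal.ofReal ((1 - s * y) ^ (-a)) *
        ENNReal.ofReal ((1 - y ^ 2) ^ (a / 2 - 1)) =
      ENNReal.ofReal ((1 - s ^ 2) ^ (-(a / 2))) *
        ∫⁻ y in Ioo (-1 : ℝ) 1, ENNReal.ofReal ((1 - y ^ 2) ^ (a / 2 - 1)) := by
  have hpos : ∀ z ∈ Ioo (-1 : ℝ) 1, 0 < 1 + s * z := fun z hz =>
    one_add_mul_pos hs (mem_Ioo_neg_one_one.1 hz)
  have hinj : InjOn (mobius s) (Ioo (-1) 1) := by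
    intro x hx y hy hxy
    rw [← mobius_neg_mobius hs (mem_Ioo_neg_one_one.1 hx), hxy,
      mobius_neg_mobius hs (mem_Ioo_neg_one_one.1 hy)]
  have h := lintegral_image_eq_lintegral_abs_deriv_mul measurableSet_Ioo
    (fun z hz => (hasDerivAt_mobius (hpos z hz).ne').hasDerivWithinAt) hinj
    (fun y => ENNReal.ofReal ((1 - s * y) ^ (-a)) * ENNReal.ofReal ((1 - y ^ 2) ^ (a / 2 - 1)))
  rw [mobius_image hs] at h
  rw [h, ← lintegral_const_mul _ (by fun_prop)]
  refine setLIntegral_congr_fun measurableSet_Ioo fun z hz => ?_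
  have hu := hpos z hz
  have hp := one_sub_sq_pos hs
  have hq := one_sub_sq_pos (mem_Ioo_neg_one_one.1 hz)
  simp only [one_sub_mul_mobius hu.ne', one_sub_mobius_sq hu.ne']
  rw [← ENNReal.ofReal_mul (by positivity), ← ENNReal.ofReal_mul (by positivity),
    ← ENNReal.ofReal_mul (by positivity)]
  congr 1
  rw [abs_of_pos (by positivity), Real.div_rpow hp.le hu.le,
    Real.div_rpow (by positivity) (by positivity), Real.mul_rpow hp.le hq.le,
    ← Real.rpow_natCast (1 + s * z) 2, ← Real.rpow_mul hu.le]
  have e1 : (1 - s ^ 2) * (1 - s ^ 2) ^ (-a) * (1 - s ^ 2) ^ (a / 2 - 1) =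
      (1 - s ^ 2) ^ (-(a / 2)) := by
    nth_rewrite 1 [← Real.rpow_one (1 - s ^ 2)]
    rw [← Real.rpow_add hp, ← Real.rpow_add hp]
    congr 1; ring
  -- The powers of `1 + s z` in the denominators of the Jacobian, the linear form and the weight
  -- cancel. This forces the weight exponent `a / 2 - 1` to go with the power `-a`.
  have e2 : (1 + s * z) ^ ((2 : ℕ) : ℝ) * (1 + s * z) ^ (-a) *
      (1 + s * z) ^ (((2 : ℕ) : ℝ) * (a / 2 - 1)) = 1 := by
    rw [← Real.rpow_add hu, ← Real.rpow_add hu]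
    convert! Real.rpow_zero _ using 2
    push_cast; ring
  rw [← e1]
  have p1 := Real.rpow_pos_of_pos hu ((2 : ℕ) : ℝ)
  have p2 := Real.rpow_pos_of_pos hu (-a)
  have p3 := Real.rpow_pos_of_pos hu (((2 : ℕ) : ℝ) * (a / 2 - 1))
  generalize (1 + s * z) ^ ((2 : ℕ) : ℝ) = x at *
  generalize (1 + s * z) ^ (-a) = y at *
  generalize (1 + s * z) ^ (((2 : ℕ) : ℝ) * (a / 2 - 1)) = w at *
  rw [div_mul_div_comm, div_mul_div_comm, div_eq_iff (by positivity)]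
  rw [← mul_assoc x, e2]
  ring

end OneDimensional

/-! ### Dirichlet means of negative powers of linear forms. -/

section Dirichlet

open Set
open scoped ENNReal

theorem lintegral_eq_mul_lintegral_comp_smul {E : Type*} [NormedAddCommGroup E] [NormedSpace ℝ E]
    [MeasurableSpace E] [BorelSpace E] [FiniteDimensional ℝ E] (κ : Measure E)
    [κ.IsAddHaarMeasure] (f : E → ℝ≥0∞) {r : ℝ} (hr : 0 < r) :
    ∫⁻ x, f x ∂κ = ENNReal.ofReal (r ^ Module.finrank ℝ E) * ∫⁻ x, f (r • x) ∂κ := by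
  have h := lintegral_map_equiv (μ := κ) f (MeasurableEquiv.smul₀ r hr.ne')
  simp only [MeasurableEquiv.coe_smul₀] at h
  rw [Measure.map_addHaar_smul κ hr.ne', lintegral_smul_measure, smul_eq_mul] at h
  rw [← h, ← mul_assoc, abs_of_pos (by positivity), ← ENNReal.ofReal_mul (by positivity),
    mul_inv_cancel₀ (by positivity), ENNReal.ofReal_one, one_mul]

theorem lintegral_pi_prod_eq_prod_lintegral {X : Type*} [MeasurableSpace X] :
    ∀ {n : ℕ} (κ : Fin n → Measure X) [∀ i, SigmaFinite (κ i)] {f : Fin n → X → ℝ≥0∞}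
      (_ : ∀ i, Measurable (f i)),
      ∫⁻ x, ∏ i, f i (x i) ∂Measure.pi κ = ∏ i, ∫⁻ x, f i x ∂κ i
  | 0, κ, _, f, _ => by simp [Measure.pi_of_empty κ]
  | n + 1, κ, _, f, hf => by
    have h := (measurePreserving_piFinSuccAbove κ 0).symm
    rw [← h.lintegral_comp_emb (MeasurableEquiv.measurableEmbedding _)]
    rw [Fin.prod_univ_succ, ← lintegral_pi_prod_eq_prod_lintegral (fun i => κ i.succ)
      fun i => hf i.succ, ← lintegral_prod_mul (hf 0).aemeasurable
        (Measurable.aemeasurable (by fun_prop))]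
    refine lintegral_congr fun p => ?_
    rw [Fin.prod_univ_succ]
    rfl

theorem sum_durations {n : ℕ} (t : ℝ) (τ : Fin n → ℝ) : ∑ k, durations t τ k = t := by
  simp [durations, Fin.sum_univ_castSucc]

theorem durations_smul {n : ℕ} (r t : ℝ) (τ : Fin n → ℝ) :
    durations (r * t) (r • τ) = r • durations t τ := by
  ext k
  refine Fin.lastCases ?_ (fun j => ?_) k
  · simp [durations, ← Finset.mul_sum, mul_sub]
  · simp [durations]

theorem durations_pos_iff {n : ℕ} {t : ℝ} {τ : Fin n → ℝ} :
    (∀ k, 0 < durations t τ k) ↔ τ ∈ timeSimplex n t := by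
  simp [durations, Fin.forall_fin_succ', timeSimplex]

theorem measurable_durations {n : ℕ} :
    Measurable fun p : ℝ × (Fin n → ℝ) => durations p.1 p.2 := by
  rw [measurable_pi_iff]
  intro k
  refine Fin.lastCases ?_ (fun j => ?_) k
  · simp only [durations, Fin.snoc_last]; fun_prop
  · simp only [durations, Fin.snoc_castSucc]; fun_prop

theorem measurableSet_forall_pos (n : ℕ) : MeasurableSet {g : Fin n → ℝ | ∀ k, 0 < g k} := by
  have : {g : Fin n → ℝ | ∀ k, 0 < g k} = univ.pi fun _ => Ioi 0 := by ext; simp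
  rw [this]
  exact MeasurableSet.univ_pi fun _ => measurableSet_Ioi

theorem measurableSet_timeSimplex (n : ℕ) (t : ℝ) : MeasurableSet (timeSimplex n t) := by
  have h : MeasurableSet {τ : Fin n → ℝ | ∑ j, τ j < t} :=
    measurableSet_lt (by fun_prop) measurable_const
  exact (measurableSet_forall_pos n).inter h

/-- Integration over the positive orthant in the coordinates given by the sum `r` of the entries
and their proportions. -/
theorem lintegral_pos_eq_lintegral_timeSimplex {n : ℕ} {t : ℝ} (ht : 0 < t)
    {F : (Fin (n + 1) → ℝ) → ℝ≥0∞} (hF : Measurable F) :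
    ∫⁻ g in {g | ∀ k, 0 < g k}, F g =
      ∫⁻ r in Ioi (0 : ℝ), ∫⁻ τ in timeSimplex n t,
        ENNReal.ofReal ((r / t) ^ n) * F ((r / t) • durations t τ) := by
  have hpos := measurableSet_forall_pos (n + 1)
  set G := indicator {g : Fin (n + 1) → ℝ | ∀ k, 0 < g k} F with hG
  have hGm : Measurable G := hF.indicator hpos
  have h := (volume_preserving_piFinSuccAbove (fun _ : Fin (n + 1) => ℝ) (Fin.last n)).symm
  have hsnoc : ∀ p : ℝ × (Fin n → ℝ),
      (MeasurableEquiv.piFinSuccAbove (fun _ => ℝ) (Fin.last n)).symm p =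
        (Fin.snoc p.2 p.1 : Fin (n + 1) → ℝ) := fun p => by
    simp [Fin.snocEquiv]
  rw [← lintegral_indicator hpos, ← h.lintegral_comp_emb (MeasurableEquiv.measurableEmbedding _),
    Measure.volume_eq_prod, lintegral_prod_symm _ (by fun_prop)]
  -- Translating the last coordinate by the sum of the others makes the total `r` the integration
  -- variable. The factor `(r / t) ^ n` then comes from rescaling the remaining `n` coordinates.
  have hshift : ∀ τ : Fin n → ℝ,
      ∫⁻ x, G ((MeasurableEquiv.piFinSuccAbove (fun _ => ℝ) (Fin.last n)).symm (x, τ)) =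
        ∫⁻ r, G (durations r τ) := fun τ => by
    rw [← lintegral_sub_right_eq_self _ (∑ j, τ j)]
    simp only [hsnoc, durations]
  have hGd : Measurable fun p : ℝ × (Fin n → ℝ) => G (durations p.1 p.2) :=
    hGm.comp measurable_durations
  simp only [← hG, hshift]
  rw [lintegral_lintegral_swap (f := fun τ r => G (durations r τ))
      (hGd.comp measurable_swap).aemeasurable, ← lintegral_indicator measurableSet_Ioi]
  refine lintegral_congr fun r => ?_
  by_cases hr : 0 < r
  · rw [indicator_of_mem (mem_Ioi.2 hr)]
    have hrt : 0 < r / t := div_pos hr ht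
    rw [lintegral_eq_mul_lintegral_comp_smul volume _ hrt, lintegral_const_mul _ (by
        exact hF.comp ((measurable_durations.comp (measurable_const.prodMk measurable_id)).const_smul
          (r / t))), ← lintegral_indicator (measurableSet_timeSimplex n t)]
    congr 1
    · simp
    refine lintegral_congr fun τ => ?_
    have e : durations r ((r / t) • τ) = (r / t) • durations t τ := by
      rw [← durations_smul, div_mul_cancel₀ _ ht.ne']
    have e2 : (∀ k, 0 < durations r ((r / t) • τ) k) ↔ τ ∈ timeSimplex n t := by
      rw [← durations_pos_iff, e]
      simp [hrt]
    by_cases hτ : τ ∈ timeSimplex n t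
    · rw [indicator_of_mem hτ, hG, indicator_of_mem (by exact e2.2 hτ), e]
    · rw [indicator_of_notMem hτ, hG, indicator_of_notMem (by exact fun h => hτ (e2.1 h))]
  -- A nonpositive total is not the sum of `n + 1` positive entries, so these `r` contribute
  -- nothing.
  · rw [indicator_of_notMem (by simpa using hr), lintegral_eq_zero_of_ae_eq_zero]
    refine Filter.Eventually.of_forall fun τ => ?_
    refine indicator_of_notMem (fun h => hr ?_) _
    rw [← sum_durations r τ]
    exact Finset.sum_pos (fun k _ => h k) Finset.univ_nonempty

theorem lintegral_rpow_mul_exp_neg_mul {a r : ℝ} (ha : 0 < a) (hr : 0 < r) :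
    ∫⁻ x in Ioi (0 : ℝ), ENNReal.ofReal (x ^ (a - 1) * Real.exp (-(r * x))) =
      ENNReal.ofReal (Real.Gamma a * r ^ (-a)) := by
  have hi : IntegrableOn (fun x : ℝ => x ^ (a - 1) * Real.exp (-(r * x))) (Ioi 0) := by
    refine Integrable.of_integral_ne_zero ?_
    rw [Real.integral_rpow_mul_exp_neg_mul_Ioi ha hr]
    have := Real.Gamma_pos_of_pos ha
    positivity
  rw [← ofReal_integral_eq_lintegral_ofReal hi, Real.integral_rpow_mul_exp_neg_mul_Ioi ha hr,
    one_div, Real.inv_rpow hr.le, Real.rpow_neg hr.le, mul_comm]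
  filter_upwards [ae_restrict_mem measurableSet_Ioi] with x hx
  exact mul_nonneg (Real.rpow_nonneg hx.le _) (Real.exp_pos _).le

/-- The Dirichlet mean of a negative power of a linear form. -/
theorem lintegral_timeSimplex_prod_mul_rpow {n : ℕ} {t a : ℝ} (ht : 0 < t) (ha : 0 < a)
    {x : Fin (n + 1) → ℝ} (hx : ∀ k, 0 < x k) :
    ENNReal.ofReal (t * Real.Gamma ((n + 1) * a)) *
      ∫⁻ τ in timeSimplex n t, ENNReal.ofReal
        ((∏ k, durations t τ k ^ (a - 1)) * (∑ k, x k * durations t τ k) ^ (-((n + 1) * a))) =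
      ENNReal.ofReal (∏ k, Real.Gamma a * x k ^ (-a)) := by
  have hA : 0 < ((n : ℝ) + 1) * a := by positivity
  set F : (Fin (n + 1) → ℝ) → ℝ≥0∞ := fun g =>
    ENNReal.ofReal (∏ k, (g k ^ (a - 1) * Real.exp (-(x k * g k)))) with hF
  have hFm : Measurable F := by fun_prop
  -- The integral of `F` is computed twice: coordinate by coordinate as a product of Gamma
  -- integrals, then in total and proportions, where the integral over the total is again a Gamma
  -- integral and leaves the Dirichlet mean.
  have h1 : ∫⁻ g in {g | ∀ k, 0 < g k}, F g =
      ENNReal.ofReal (∏ k, Real.Gamma a * x k ^ (-a)) := by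
    rw [ENNReal.ofReal_prod_of_nonneg fun k _ =>
      mul_nonneg (Real.Gamma_pos_of_pos ha).le (Real.rpow_nonneg (hx k).le _)]
    simp only [← lintegral_rpow_mul_exp_neg_mul ha (hx _)]
    rw [← lintegral_pi_prod_eq_prod_lintegral (fun _ => volume.restrict (Ioi (0 : ℝ)))
      (fun k => by fun_prop), ← Measure.restrict_pi_pi, ← volume_pi]
    have : (univ.pi fun _ : Fin (n + 1) => Ioi (0 : ℝ)) = {g | ∀ k, 0 < g k} := by
      ext; simp
    rw [this]
    refine setLIntegral_congr_fun (this ▸ MeasurableSet.univ_pi fun _ => measurableSet_Ioi) ?_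
    intro g hg
    exact ENNReal.ofReal_prod_of_nonneg fun k _ =>
      mul_nonneg (Real.rpow_nonneg (hg k).le _) (Real.exp_pos _).le
  rw [← h1, lintegral_pos_eq_lintegral_timeSimplex ht hFm]
  have hd : Measurable fun p : ℝ × (Fin n → ℝ) => durations t p.2 :=
    measurable_durations.comp (measurable_const.prodMk measurable_snd)
  have hd' : ∀ k, Measurable fun τ : Fin n → ℝ => durations t τ k := fun k =>
    (measurable_pi_apply k).comp
      (measurable_durations.comp (measurable_const.prodMk measurable_id))
  rw [lintegral_lintegral_swap (by
    refine (Measurable.mul (by fun_prop) (hFm.comp ?_)).aemeasurable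
    rw [measurable_pi_iff]
    intro k
    exact (by fun_prop : Measurable fun p : ℝ × (Fin n → ℝ) => p.1 / t).mul
      ((measurable_pi_apply k).comp hd)), ← lintegral_const_mul _ (by fun_prop)]
  refine setLIntegral_congr_fun (measurableSet_timeSimplex n t) fun τ hτ => ?_
  have hp := durations_pos_iff.2 hτ
  set S := ∑ k, x k * durations t τ k with hS
  have hSpos : 0 < S := Finset.sum_pos (fun k _ => mul_pos (hx k) (hp k)) Finset.univ_nonempty
  have hD : 0 < ∏ k, durations t τ k ^ (a - 1) :=
    Finset.prod_pos fun k _ => Real.rpow_pos_of_pos (hp k) _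
  have h2 : ∀ r ∈ Ioi (0 : ℝ), ENNReal.ofReal ((r / t) ^ n) * F ((r / t) • durations t τ) =
      ENNReal.ofReal ((∏ k, durations t τ k ^ (a - 1)) * t ^ (1 - (n + 1) * a)) *
        ENNReal.ofReal (r ^ ((n + 1) * a - 1) * Real.exp (-((S / t) * r))) := by
    intro r hr
    have hr : 0 < r := hr
    have hrt : 0 < r / t := div_pos hr ht
    rw [hF, ← ENNReal.ofReal_mul (by positivity), ← ENNReal.ofReal_mul (by positivity)]
    congr 1
    simp only [Pi.smul_apply, smul_eq_mul]
    simp_rw [Real.mul_rpow hrt.le (hp _).le]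
    rw [Finset.prod_mul_distrib, Finset.prod_mul_distrib, Finset.prod_const, ← Real.exp_sum,
      Finset.card_univ, Fintype.card_fin]
    have e1 : ∑ k, -(x k * (r / t * durations t τ k)) = -((S / t) * r) := by
      rw [Finset.sum_neg_distrib, hS, Finset.sum_div, Finset.sum_mul]
      congr 1
      refine Finset.sum_congr rfl fun k _ => ?_
      ring
    have e2 : (r / t) ^ n * ((r / t) ^ (a - 1)) ^ (n + 1) =
        r ^ ((n + 1) * a - 1) * t ^ (1 - (n + 1) * a) := by
      rw [← Real.rpow_natCast, ← Real.rpow_natCast, ← Real.rpow_mul hrt.le, ← Real.rpow_add hrt,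
        show (n : ℝ) + (a - 1) * ((n + 1 : ℕ) : ℝ) = (n + 1) * a - 1 by push_cast; ring,
        Real.div_rpow hr.le ht.le, div_eq_mul_inv, ← Real.rpow_neg ht.le]
      congr 2; ring
    rw [e1]
    linear_combination (∏ k, durations t τ k ^ (a - 1)) * Real.exp (-((S / t) * r)) * e2
  rw [setLIntegral_congr_fun measurableSet_Ioi h2, lintegral_const_mul _ (by fun_prop),
    lintegral_rpow_mul_exp_neg_mul hA (div_pos hSpos ht), ← ENNReal.ofReal_mul (by positivity),
    ← ENNReal.ofReal_mul (mul_nonneg hD.le (Real.rpow_nonneg ht.le _))]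
  congr 1
  have e : t ^ (1 - ((n : ℝ) + 1) * a) = t * t ^ (-(((n : ℝ) + 1) * a)) := by
    rw [sub_eq_add_neg, Real.rpow_add ht, Real.rpow_one]
  have : t ^ (-(((n : ℝ) + 1) * a)) ≠ 0 := (Real.rpow_pos_of_pos ht _).ne'
  rw [Real.div_rpow hSpos.le ht.le, e]
  field_simp

end Dirichlet

/-! ### One-dimensional projections of a random direction. -/

section Directions

open Set
open scoped ENNReal

/-- Integration over `(0, π)` in the variable `y = cos θ`. -/
theorem lintegral_Ioo_zero_pi_comp_cos (G : ℝ → ℝ → ℝ≥0∞) (p : ℝ) :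
    ∫⁻ θ in Ioo 0 Real.pi, G (Real.cos θ) (Real.sin θ) * ENNReal.ofReal (|Real.sin θ| ^ p) =
      ∫⁻ y in Ioo (-1 : ℝ) 1, G y (√(1 - y ^ 2)) *
        ENNReal.ofReal ((1 - y ^ 2) ^ ((p - 1) / 2)) := by
  have himage : Real.cos '' Ioo 0 Real.pi = Ioo (-1) 1 := by
    ext y
    constructor
    · rintro ⟨θ, hθ, rfl⟩
      have h1 := Real.strictAntiOn_cos ⟨le_rfl, Real.pi_pos.le⟩ ⟨hθ.1.le, hθ.2.le⟩ hθ.1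
      have h2 := Real.strictAntiOn_cos ⟨hθ.1.le, hθ.2.le⟩ ⟨Real.pi_pos.le, le_rfl⟩ hθ.2
      simp only [Real.cos_zero, Real.cos_pi] at h1 h2
      exact ⟨h2, h1⟩
    · rintro ⟨h1, h2⟩
      exact ⟨Real.arccos y, ⟨Real.arccos_pos.2 h2, Real.arccos_lt_pi.2 h1⟩,
        Real.cos_arccos h1.le h2.le⟩
  have h := lintegral_image_eq_lintegral_abs_deriv_mul (s := Ioo 0 Real.pi) measurableSet_Ioo
    (fun θ _ => (Real.hasDerivAt_cos θ).hasDerivWithinAt)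
    (Real.injOn_cos.mono Ioo_subset_Icc_self)
    (fun y => G y (√(1 - y ^ 2)) * ENNReal.ofReal ((1 - y ^ 2) ^ ((p - 1) / 2)))
  rw [himage] at h
  rw [h]
  refine setLIntegral_congr_fun measurableSet_Ioo fun θ hθ => ?_
  have hs := Real.sin_pos_of_pos_of_lt_pi hθ.1 hθ.2
  have hsq : 1 - Real.cos θ ^ 2 = Real.sin θ ^ 2 := by rw [Real.sin_sq]
  rw [hsq, Real.sqrt_sq hs.le, mul_left_comm, abs_neg, abs_of_pos hs,
    ← ENNReal.ofReal_mul hs.le]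
  congr 2
  rw [← Real.rpow_natCast, ← Real.rpow_mul hs.le]
  nth_rewrite 2 [← Real.rpow_one (Real.sin θ)]
  rw [← Real.rpow_add hs]
  congr 1
  push_cast; ring

theorem lintegral_Ioo_neg_comp_mul (h : ℝ → ℝ≥0∞) {r : ℝ} (hr : 0 < r) :
    ∫⁻ z in Ioo (-r) r, h z = ENNReal.ofReal r * ∫⁻ w in Ioo (-1 : ℝ) 1, h (r * w) := by
  rw [← lintegral_indicator measurableSet_Ioo, ← lintegral_indicator measurableSet_Ioo,
    lintegral_eq_mul_lintegral_comp_smul volume _ hr]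
  simp only [Module.finrank_self, pow_one]
  congr 1
  refine lintegral_congr fun w => ?_
  have : r • w ∈ Ioo (-r) r ↔ w ∈ Ioo (-1 : ℝ) 1 := by
    rw [smul_eq_mul, mem_Ioo, mem_Ioo]
    constructor
    · rintro ⟨h1, h2⟩; constructor <;> nlinarith
    · rintro ⟨h1, h2⟩; constructor <;> nlinarith
  by_cases hw : w ∈ Ioo (-1 : ℝ) 1
  · rw [indicator_of_mem hw, indicator_of_mem (this.2 hw), smul_eq_mul]
  · rw [indicator_of_notMem hw, indicator_of_notMem (fun h => hw (this.1 h))]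

/-- Integration over the unit disc with weight `(1 - |z|²)^e`. -/
theorem lintegral_disc_eq (F : ℝ → ℝ → ℝ≥0∞) (hF : Measurable fun p : ℝ × ℝ => F p.1 p.2)
    (e : ℝ) :
    ∫⁻ z in Metric.ball (0 : ℂ) 1, F z.re z.im * ENNReal.ofReal ((1 - ‖z‖ ^ 2) ^ e) =
      ∫⁻ y in Ioo (-1 : ℝ) 1, (∫⁻ w in Ioo (-1 : ℝ) 1, F y (√(1 - y ^ 2) * w) *
        ENNReal.ofReal ((1 - w ^ 2) ^ e)) * ENNReal.ofReal ((1 - y ^ 2) ^ (e + 1 / 2)) := by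
  set H : ℝ × ℝ → ℝ≥0∞ := indicator {p | p.1 ^ 2 + p.2 ^ 2 < 1} fun p =>
    F p.1 p.2 * ENNReal.ofReal ((1 - (p.1 ^ 2 + p.2 ^ 2)) ^ e) with hH
  have hHm : Measurable H := by
    refine Measurable.indicator (hF.mul (by fun_prop)) ?_
    exact measurableSet_lt (by fun_prop) measurable_const
  have h1 : ∫⁻ z in Metric.ball (0 : ℂ) 1, F z.re z.im * ENNReal.ofReal ((1 - ‖z‖ ^ 2) ^ e) =
      ∫⁻ p, H p := by
    rw [← Complex.volume_preserving_equiv_real_prod.lintegral_comp hHm,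
      ← lintegral_indicator measurableSet_ball]
    refine lintegral_congr fun z => ?_
    have hn : ‖z‖ ^ 2 = z.re ^ 2 + z.im ^ 2 := by
      rw [Complex.sq_norm, Complex.normSq_apply]; ring
    have hz : z ∈ Metric.ball (0 : ℂ) 1 ↔ z.re ^ 2 + z.im ^ 2 < 1 := by
      rw [mem_ball_zero_iff, ← hn, sq_lt_one_iff₀ (norm_nonneg z)]
    by_cases h : z ∈ Metric.ball (0 : ℂ) 1
    · rw [indicator_of_mem h, hH, indicator_of_mem (by exact hz.1 h), hn]
      rfl
    · rw [indicator_of_notMem h, hH, indicator_of_notMem (by exact fun h' => h (hz.2 h'))]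
  rw [h1, Measure.volume_eq_prod, lintegral_prod _ hHm.aemeasurable,
    ← lintegral_indicator measurableSet_Ioo]
  refine lintegral_congr fun y => ?_
  by_cases hy : y ∈ Ioo (-1 : ℝ) 1
  · have hpos := one_sub_sq_pos (mem_Ioo_neg_one_one.1 hy)
    set r := √(1 - y ^ 2) with hr
    have hr0 : 0 < r := Real.sqrt_pos.2 hpos
    have hr2 : r ^ 2 = 1 - y ^ 2 := Real.sq_sqrt hpos.le
    have e1 : ∀ z, H (y, z) = indicator (Ioo (-r) r)
        (fun z => F y z * ENNReal.ofReal ((1 - (y ^ 2 + z ^ 2)) ^ e)) z := by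
      intro z
      have : z ∈ Ioo (-r) r ↔ y ^ 2 + z ^ 2 < 1 := by
        rw [mem_Ioo, ← abs_lt, ← sq_lt_sq₀ (abs_nonneg z) hr0.le, hr2, sq_abs]
        constructor <;> intro h <;> linarith
      by_cases hz : z ∈ Ioo (-r) r
      · rw [indicator_of_mem hz, hH, indicator_of_mem (by exact this.1 hz)]
      · rw [indicator_of_notMem hz, hH, indicator_of_notMem (by exact fun h => hz (this.2 h))]
    simp only [e1]
    -- Rescaling the chord `(-r, r)` to `(-1, 1)` contributes `r = (1 - y²) ^ (1 / 2)`, the source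
    -- of the exponent `e + 1 / 2`.
    rw [lintegral_indicator measurableSet_Ioo, lintegral_Ioo_neg_comp_mul _ hr0,
      indicator_of_mem hy, mul_comm, ← lintegral_mul_const' _ _ ENNReal.ofReal_ne_top,
      ← lintegral_mul_const' _ _ ENNReal.ofReal_ne_top]
    refine setLIntegral_congr_fun measurableSet_Ioo fun w hw => ?_
    have hw := one_sub_sq_pos (mem_Ioo_neg_one_one.1 hw)
    rw [mul_assoc, mul_assoc, ← ENNReal.ofReal_mul (by
      rw [show 1 - (y ^ 2 + (r * w) ^ 2) = r ^ 2 * (1 - w ^ 2) by rw [mul_pow, hr2]; ring]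
      positivity), ← ENNReal.ofReal_mul (by positivity)]
    congr 2
    rw [show 1 - (y ^ 2 + (r * w) ^ 2) = (1 - y ^ 2) * (1 - w ^ 2) by rw [mul_pow, hr2]; ring,
      Real.mul_rpow hpos.le hw.le, Real.rpow_add hpos, hr, Real.sqrt_eq_rpow]
    ring
  · rw [indicator_of_notMem hy]
    refine lintegral_eq_zero_of_ae_eq_zero (Filter.Eventually.of_forall fun z => ?_)
    refine indicator_of_notMem (fun h => hy ?_) _
    rw [mem_Ioo_neg_one_one, ← sq_lt_one_iff_abs_lt_one]
    have : y ^ 2 + z ^ 2 < 1 := h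
    nlinarith [sq_nonneg z]

/-- Rotation invariance on the disc, in the coordinates of `lintegral_disc_eq`. -/
theorem lintegral_disc_linear {f : ℝ → ℝ≥0∞} (hf : Measurable f) (e s ρ : ℝ) :
    ∫⁻ y in Ioo (-1 : ℝ) 1, (∫⁻ w in Ioo (-1 : ℝ) 1, f (s * y + √(1 - y ^ 2) * (ρ * w)) *
        ENNReal.ofReal ((1 - w ^ 2) ^ e)) * ENNReal.ofReal ((1 - y ^ 2) ^ (e + 1 / 2)) =
      (∫⁻ w in Ioo (-1 : ℝ) 1, ENNReal.ofReal ((1 - w ^ 2) ^ e)) *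
        ∫⁻ y in Ioo (-1 : ℝ) 1, f (√(s ^ 2 + ρ ^ 2) * y) *
          ENNReal.ofReal ((1 - y ^ 2) ^ (e + 1 / 2)) := by
  set σ := √(s ^ 2 + ρ ^ 2) with hσ
  have hL := lintegral_disc_eq (fun y z => f (s * y + ρ * z)) (by fun_prop) e
  have hR := lintegral_disc_eq (fun y _ => f (σ * y)) (by fun_prop) e
  -- Multiplication by the unit number `(s - iρ) / σ` takes the vector `(s, ρ)` to `(σ, 0)`; for `σ
  -- = 0` both sides vanish.
  have hrot : ∃ L : ℂ ≃ₗᵢ[ℝ] ℂ, ∀ z, s * z.re + ρ * z.im = σ * (L z).re := by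
    rcases eq_or_ne σ 0 with h0 | h0
    · have h : s ^ 2 + ρ ^ 2 = 0 := (Real.sqrt_eq_zero (by positivity)).1 h0
      have hs : s = 0 := by nlinarith [sq_nonneg s, sq_nonneg ρ]
      have hρ : ρ = 0 := by nlinarith [sq_nonneg s, sq_nonneg ρ]
      exact ⟨.refl ℝ ℂ, by simp [h0, hs, hρ]⟩
    · have hσ2 : σ ^ 2 = s ^ 2 + ρ ^ 2 := Real.sq_sqrt (by positivity)
      let ζ : Circle := ⟨⟨s / σ, -ρ / σ⟩, by
        change _ ∈ Metric.sphere (0 : ℂ) 1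
        rw [mem_sphere_zero_iff_norm, ← sq_eq_sq₀ (norm_nonneg _) zero_le_one, Complex.sq_norm,
          Complex.normSq_mk]
        field_simp
        linarith⟩
      refine ⟨rotation ζ, fun z => ?_⟩
      rw [rotation_apply, Complex.mul_re]
      simp only [ζ]
      field_simp
      ring
  obtain ⟨L, hLz⟩ := hrot
  have hmp := L.measurePreserving
  have key : ∫⁻ z in Metric.ball (0 : ℂ) 1,
      f (s * z.re + ρ * z.im) * ENNReal.ofReal ((1 - ‖z‖ ^ 2) ^ e) =
      ∫⁻ z in Metric.ball (0 : ℂ) 1, f (σ * z.re) * ENNReal.ofReal ((1 - ‖z‖ ^ 2) ^ e) := by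
    have h := hmp.setLIntegral_comp_preimage (measurableSet_ball (x := (0 : ℂ)) (ε := 1))
      (f := fun z => f (σ * z.re) * ENNReal.ofReal ((1 - ‖z‖ ^ 2) ^ e)) (by fun_prop)
    have hball : L ⁻¹' Metric.ball 0 1 = Metric.ball 0 1 := by ext z; simp
    rw [← h, hball]
    simp only [hLz, LinearIsometryEquiv.norm_map]
  simp only [hL, hR] at key
  rw [← lintegral_const_mul _ (by fun_prop)]
  simp only [mul_left_comm _ ρ, key]
  refine lintegral_congr fun y => ?_
  rw [lintegral_const_mul _ (by fun_prop)]
  ring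

/-- The inner product of `s` with the direction with angles `θ`, for `s` orthogonal to the last
coordinate axis. -/
def angularForm {N : ℕ} (s θ : Fin N → ℝ) : ℝ :=
  ∑ i, s i * ((∏ j : Fin N, if j.val < i.val then Real.sin (θ j) else 1) * Real.cos (θ i))

theorem angularForm_cons {N : ℕ} (s : Fin (N + 1) → ℝ) (θ₀ : ℝ) (θ : Fin N → ℝ) :
    angularForm s (Fin.cons θ₀ θ) =
      s 0 * Real.cos θ₀ + Real.sin θ₀ * angularForm (Fin.tail s) θ := by
  simp only [angularForm, Fin.sum_univ_succ, Fin.prod_univ_succ, Fin.cons_zero, Fin.cons_succ,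
    Finset.mul_sum, Fin.tail]
  simp
  refine Finset.sum_congr rfl fun i _ => ?_
  ring

theorem measurable_angularForm {N : ℕ} (s : Fin N → ℝ) : Measurable (angularForm s) := by
  unfold angularForm
  refine Finset.measurable_fun_sum _ fun i _ => Measurable.const_mul (Measurable.mul ?_ ?_) _
  · refine Finset.measurable_fun_prod _ fun j _ => ?_
    split_ifs <;> fun_prop
  · fun_prop

/-- Peeling off the first angle leaves a Cauchy–Schwarz inequality against `(cos θ₀, sin θ₀)`. It
makes `1 - ⟪s, v⟫` positive for `‖s‖ < 1`. -/
theorem angularForm_sq_le : ∀ {N : ℕ} (s θ : Fin N → ℝ), angularForm s θ ^ 2 ≤ ∑ i, s i ^ 2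
  | 0, s, θ => by simp [angularForm]
  | N + 1, s, θ => by
    rw [← Fin.cons_self_tail θ, angularForm_cons, Fin.sum_univ_succ]
    have h := angularForm_sq_le (Fin.tail s) (Fin.tail θ)
    set q := angularForm (Fin.tail s) (Fin.tail θ)
    simp only [Fin.tail] at h
    have h1 := Real.sin_sq_add_cos_sq (θ 0)
    nlinarith [sq_nonneg (s 0 * Real.sin (θ 0) - q * Real.cos (θ 0))]

/-- The angle box, indexed by the number of angles. -/
def angleRange (N : ℕ) : Set (Fin N → ℝ) :=
  {θ | ∀ j : Fin N, θ j ∈ Icc 0 (if j.val + 1 = N then 2 * Real.pi else Real.pi)}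

/-- The weight `∏ j, |sin θ_j| ^ (b + N - 1 - j)`. -/
def angleWeight (N : ℕ) (b : ℝ) (θ : Fin N → ℝ) : ℝ :=
  ∏ j : Fin N, |Real.sin (θ j)| ^ (b + N - 1 - (j.val : ℝ))

theorem angleWeight_cons {N : ℕ} (b θ₀ : ℝ) (θ : Fin N → ℝ) :
    angleWeight (N + 1) b (Fin.cons θ₀ θ) = |Real.sin θ₀| ^ (b + N) * angleWeight N b θ := by
  simp only [angleWeight, Fin.prod_univ_succ, Fin.cons_zero, Fin.cons_succ]
  congr 1
  · congr 1; simp; ring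
  · refine Finset.prod_congr rfl fun j _ => ?_
    congr 1; rw [Fin.val_succ]; push_cast; ring

theorem measurable_angleWeight (N : ℕ) (b : ℝ) : Measurable (angleWeight N b) := by
  unfold angleWeight
  fun_prop

theorem lintegral_Icc_zero_two_pi {g : ℝ → ℝ≥0∞} (hg : ∀ φ, g (2 * Real.pi - φ) = g φ) :
    ∫⁻ φ in Icc 0 (2 * Real.pi), g φ = 2 * ∫⁻ φ in Ioo 0 Real.pi, g φ := by
  have hpi := Real.pi_pos
  have h1 : ∫⁻ φ in Ioc Real.pi (2 * Real.pi), g φ = ∫⁻ φ in Ioo 0 Real.pi, g φ := by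
    rw [← restrict_Ioo_eq_restrict_Ioc, ← lintegral_indicator measurableSet_Ioo,
      ← lintegral_indicator measurableSet_Ioo, ← lintegral_sub_left_eq_self _ (2 * Real.pi)]
    refine lintegral_congr fun φ => ?_
    simp only [indicator, mem_Ioo, hg]
    congr 1
    apply propext
    constructor <;> rintro ⟨h1, h2⟩ <;> constructor <;> linarith
  rw [← Icc_union_Ioc_eq_Icc hpi.le (by linarith), lintegral_union measurableSet_Ioc
    (Set.disjoint_left.2 fun x hx hx' => absurd hx.2 (not_le.2 hx'.1)), h1,
    ← restrict_Ioo_eq_restrict_Icc, two_mul]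

theorem lintegral_Ioo_abs_mul (f : ℝ → ℝ≥0∞) (s e : ℝ) :
    ∫⁻ y in Ioo (-1 : ℝ) 1, f (s * y) * ENNReal.ofReal ((1 - y ^ 2) ^ e) =
      ∫⁻ y in Ioo (-1 : ℝ) 1, f (|s| * y) * ENNReal.ofReal ((1 - y ^ 2) ^ e) := by
  rcases abs_choice s with h | h
  · rw [h]
  · rw [h, ← lintegral_indicator measurableSet_Ioo, ← lintegral_indicator measurableSet_Ioo,
      ← lintegral_neg_eq_self]
    refine lintegral_congr fun y => ?_
    have : -y ∈ Ioo (-1 : ℝ) 1 ↔ y ∈ Ioo (-1 : ℝ) 1 := by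
      rw [mem_Ioo_neg_one_one, mem_Ioo_neg_one_one, abs_neg]
    simp only [indicator, this, mul_neg, neg_mul, even_two.neg_pow]

/-- Under the weight of the angles, the component of the direction along `s` has a symmetric beta
law on the interval `(-|s|, |s|)`. -/
theorem exists_lintegral_angularForm (b : ℝ) : ∀ N : ℕ, ∃ C : ℝ≥0∞, ∀ (f : ℝ → ℝ≥0∞)
    (_ : Measurable f) (s : Fin (N + 1) → ℝ),
    ∫⁻ θ in angleRange (N + 1), f (angularForm s θ) *
        ENNReal.ofReal (angleWeight (N + 1) b θ) =
      C * ∫⁻ y in Ioo (-1 : ℝ) 1, f (√(∑ i, s i ^ 2) * y) *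
        ENNReal.ofReal ((1 - y ^ 2) ^ ((b + (N + 1 : ℕ)) / 2 - 1))
  | 0 => by
    -- The factor `2` counts the two halves of `[0, 2π]`, on which `cos φ` and `|sin φ|` take the
    -- same values.
    refine ⟨2, fun f hf s => ?_⟩
    have h := (volume_preserving_funUnique (Fin 1) ℝ).symm
    have hset : (MeasurableEquiv.funUnique (Fin 1) ℝ).symm ⁻¹' angleRange 1 =
        Icc 0 (2 * Real.pi) := by
      ext x; simp [angleRange]
    change ∫⁻ θ : Fin 1 → ℝ in angleRange 1, f (angularForm (N := 1) s θ) *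
      ENNReal.ofReal (angleWeight 1 b θ) = _
    have h' := h.setLIntegral_comp_preimage_emb (MeasurableEquiv.measurableEmbedding _)
      (fun θ => f (angularForm (N := 1) s θ) * ENNReal.ofReal (angleWeight 1 b θ)) (angleRange 1)
    rw [hset] at h'
    refine Eq.trans (by convert! h'.symm using 3) ?_
    have hval : ∀ φ : ℝ, f (angularForm s ((MeasurableEquiv.funUnique (Fin 1) ℝ).symm φ)) *
        ENNReal.ofReal (angleWeight 1 b ((MeasurableEquiv.funUnique (Fin 1) ℝ).symm φ)) =
        f (s 0 * Real.cos φ) * ENNReal.ofReal (|Real.sin φ| ^ b) := by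
      intro φ; simp [angularForm, angleWeight]
    simp only [zero_add, hval]
    rw [lintegral_Icc_zero_two_pi fun φ => by
      rw [Real.cos_two_pi_sub, Real.sin_two_pi_sub, abs_neg],
      lintegral_Ioo_zero_pi_comp_cos (fun y _ => f (s 0 * y)) b, lintegral_Ioo_abs_mul]
    simp only [Fin.sum_univ_succ, Real.sqrt_sq_eq_abs, Finset.univ_eq_empty, Finset.sum_empty,
      add_zero]
    rw [show (b + ((1 : ℕ) : ℝ)) / 2 - 1 = (b - 1) / 2 by push_cast; ring]
  | N + 1 => by
    obtain ⟨C, hC⟩ := exists_lintegral_angularForm b N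
    refine ⟨C * ∫⁻ w in Ioo (-1 : ℝ) 1,
      ENNReal.ofReal ((1 - w ^ 2) ^ ((b + (N + 1 : ℕ)) / 2 - 1)), fun f hf s => ?_⟩
    have h := (volume_preserving_piFinSuccAbove (fun _ : Fin (N + 2) => ℝ) 0).symm
    have hcons : ∀ p : ℝ × (Fin (N + 1) → ℝ),
        (MeasurableEquiv.piFinSuccAbove (fun _ => ℝ) 0).symm p =
          (Fin.cons p.1 p.2 : Fin (N + 2) → ℝ) := fun p => by
      simp [Fin.consEquiv]
    have hset : (MeasurableEquiv.piFinSuccAbove (fun _ : Fin (N + 2) => ℝ) 0).symm ⁻¹'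
        angleRange (N + 2) = Icc 0 Real.pi ×ˢ angleRange (N + 1) := by
      ext p
      rw [mem_preimage, hcons]
      simp [angleRange, Fin.forall_fin_succ (n := N + 1)]
    rw [← h.setLIntegral_comp_preimage_emb (MeasurableEquiv.measurableEmbedding _), hset,
      Measure.volume_eq_prod, ← Measure.prod_restrict]
    simp only [hcons, angularForm_cons, angleWeight_cons]
    have hm := measurable_angularForm (Fin.tail s)
    have hw := measurable_angleWeight (N + 1) b
    rw [lintegral_prod _ (Measurable.aemeasurable (by fun_prop)), ← restrict_Ioo_eq_restrict_Icc]
    -- For fixed first angle, the induction hypothesis applied to `x ↦ f (s 0 * cos θ₀ + sin θ₀ *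
    -- x)` replaces all other angles by one variable `w`.
    have hinner : ∀ θ₀ : ℝ, ∫⁻ θ in angleRange (N + 1),
        f (s 0 * Real.cos θ₀ + Real.sin θ₀ * angularForm (Fin.tail s) θ) *
          ENNReal.ofReal (|Real.sin θ₀| ^ (b + (N + 1 : ℕ)) * angleWeight (N + 1) b θ) =
        C * (∫⁻ w in Ioo (-1 : ℝ) 1,
          f (s 0 * Real.cos θ₀ + Real.sin θ₀ * (√(∑ i, Fin.tail s i ^ 2) * w)) *
            ENNReal.ofReal ((1 - w ^ 2) ^ ((b + (N + 1 : ℕ)) / 2 - 1))) *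
          ENNReal.ofReal (|Real.sin θ₀| ^ (b + (N + 1 : ℕ))) := fun θ₀ => by
      rw [← hC (fun x => f (s 0 * Real.cos θ₀ + Real.sin θ₀ * x)) (by fun_prop),
        ← lintegral_mul_const _ (by fun_prop)]
      refine lintegral_congr fun θ => ?_
      rw [ENNReal.ofReal_mul (by positivity)]
      ring
    simp only [hinner]
    rw [lintegral_Ioo_zero_pi_comp_cos (fun y z => C * ∫⁻ w in Ioo (-1 : ℝ) 1,
      f (s 0 * y + z * (√(∑ i, Fin.tail s i ^ 2) * w)) *
        ENNReal.ofReal ((1 - w ^ 2) ^ ((b + (N + 1 : ℕ)) / 2 - 1)))]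
    simp only [mul_assoc C]
    rw [lintegral_const_mul]
    -- With `y = cos θ₀` the pair `(y, w)` parametrizes the unit disc, where rotation invariance
    -- merges `s 0` and the norm of the tail into the norm of `s`.
    · have hd := lintegral_disc_linear hf ((b + (N + 1 : ℕ)) / 2 - 1) (s 0)
        (√(∑ i, Fin.tail s i ^ 2))
      rw [show (b + (N + 1 : ℕ)) / 2 - 1 + 1 / 2 = (b + (N + 1 : ℕ) - 1) / 2 by ring,
        Real.sq_sqrt (by positivity)] at hd
      rw [hd, Fin.sum_univ_succ (n := N + 1)]
      simp only [Fin.tail]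
      rw [show (b + ((N + 1 + 1 : ℕ) : ℝ)) / 2 - 1 = (b + (N + 1 : ℕ) - 1) / 2 by
        push_cast; ring]
    · refine Measurable.mul ?_ (by fun_prop)
      exact Measurable.lintegral_prod_right' (f := fun p : ℝ × ℝ =>
        f (s 0 * p.1 + √(1 - p.1 ^ 2) * (√(∑ i, Fin.tail s i ^ 2) * p.2)) *
          ENNReal.ofReal ((1 - p.2 ^ 2) ^ ((b + (N + 1 : ℕ)) / 2 - 1))) (by fun_prop)

end Directions

/-! ### Marginals and transform of the power weight on the ball. -/

section BallLaw

open Set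
open scoped ENNReal RealInnerProductSpace

/-- The affine change `y = 2u - 1` gives a beta integral with both parameters `e + 1`; the
duplication formula for `Γ` puts it in a form that telescopes over dimensions. -/
theorem lintegral_one_sub_sq_rpow {e : ℝ} (he : -1 < e) :
    ∫⁻ y in Ioo (-1 : ℝ) 1, ENNReal.ofReal ((1 - y ^ 2) ^ e) =
      ENNReal.ofReal (√Real.pi * Real.Gamma (e + 1) / Real.Gamma (e + 3 / 2)) := by
  have he1 : 0 < e + 1 := by linarith
  have himage : (fun u : ℝ => 2 * u - 1) '' Ioo 0 1 = Ioo (-1) 1 := by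
    ext y
    constructor
    · rintro ⟨u, hu, rfl⟩
      constructor <;> simp only <;> linarith [hu.1, hu.2]
    · intro hy
      exact ⟨(y + 1) / 2, ⟨by linarith [hy.1], by linarith [hy.2]⟩, by ring⟩
  have h := lintegral_image_eq_lintegral_abs_deriv_mul (s := Ioo (0 : ℝ) 1)
    (f := fun u : ℝ => 2 * u - 1) (f' := fun _ => 2) measurableSet_Ioo
    (fun u _ => by
      simpa using (((hasDerivAt_id u).const_mul 2).sub_const 1).hasDerivWithinAt)
    (fun x _ y _ hxy => by simpa using hxy) (fun y => ENNReal.ofReal ((1 - y ^ 2) ^ e))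
  rw [himage] at h
  have hb := beta_pos he1 he1
  have h1 := lintegral_betaPDF_eq_one he1 he1
  rw [lintegral_betaPDF] at h1
  have h2 : ∫⁻ u in Ioo (0 : ℝ) 1, ENNReal.ofReal |2| * ENNReal.ofReal ((1 - (2 * u - 1) ^ 2) ^ e) =
      ENNReal.ofReal (2 * 4 ^ e * beta (e + 1) (e + 1)) * 1 := by
    rw [← h1, ← lintegral_const_mul _ (by fun_prop)]
    refine setLIntegral_congr_fun measurableSet_Ioo fun u hu => ?_
    have hu0 := hu.1
    have hu1 : 0 < 1 - u := by linarith [hu.2]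
    rw [← ENNReal.ofReal_mul (by positivity), ← ENNReal.ofReal_mul (by positivity)]
    congr 1
    rw [show 1 - (2 * u - 1) ^ 2 = 4 * (u * (1 - u)) by ring,
      Real.mul_rpow (by positivity) (by positivity), Real.mul_rpow hu0.le hu1.le,
      add_sub_cancel_right, abs_of_pos (by norm_num)]
    field_simp
  rw [h, h2, mul_one, beta]
  congr 1
  have hd := Real.Gamma_mul_Gamma_add_half (e + 1)
  rw [show e + 1 + 1 / 2 = e + 3 / 2 by ring] at hd
  have g1 := Real.Gamma_pos_of_pos he1
  have g2 : 0 < Real.Gamma (e + 3 / 2) := Real.Gamma_pos_of_pos (by linarith)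
  have g3 : 0 < Real.Gamma (e + 1 + (e + 1)) := Real.Gamma_pos_of_pos (by linarith)
  rw [show 2 * (e + 1) = e + 1 + (e + 1) by ring] at hd
  have hp : (2 : ℝ) * 4 ^ e * 2 ^ (1 - (e + 1 + (e + 1))) = 1 := by
    rw [show (4 : ℝ) = 2 ^ (2 : ℝ) by norm_num, ← Real.rpow_mul (by norm_num)]
    nth_rewrite 1 [← Real.rpow_one (2 : ℝ)]
    rw [← Real.rpow_add (by norm_num), ← Real.rpow_add (by norm_num)]
    convert! Real.rpow_zero _ using 2
    ring
  rw [mul_div_assoc', div_eq_div_iff g3.ne' g2.ne']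
  calc 2 * (4 : ℝ) ^ e * (Real.Gamma (e + 1) * Real.Gamma (e + 1)) * Real.Gamma (e + 3 / 2)
      = 2 * 4 ^ e * Real.Gamma (e + 1) * (Real.Gamma (e + 1) * Real.Gamma (e + 3 / 2)) := by ring
    _ = (2 * (4 : ℝ) ^ e * 2 ^ (1 - (e + 1 + (e + 1)))) *
        (√Real.pi * Real.Gamma (e + 1) * Real.Gamma (e + 1 + (e + 1))) := by rw [hd]; ring
    _ = _ := by rw [hp, one_mul]

theorem measurableSet_sum_sq_lt (k : ℕ) (r : ℝ) :
    MeasurableSet {x : Fin k → ℝ | ∑ i, x i ^ 2 < r} :=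
  measurableSet_lt (by fun_prop) measurable_const

/-- The first marginal of the weight `(1 - |x|²)^e` on the unit ball. -/
theorem lintegral_sum_sq_lt_one_eq {k : ℕ} {G : ℝ → ℝ≥0∞} (hG : Measurable G) (e : ℝ) :
    ∫⁻ x in {x : Fin (k + 1) → ℝ | ∑ i, x i ^ 2 < 1},
        G (x 0) * ENNReal.ofReal ((1 - ∑ i, x i ^ 2) ^ e) =
      (∫⁻ w in {w : Fin k → ℝ | ∑ i, w i ^ 2 < 1}, ENNReal.ofReal ((1 - ∑ i, w i ^ 2) ^ e)) *
        ∫⁻ y in Ioo (-1 : ℝ) 1, G y * ENNReal.ofReal ((1 - y ^ 2) ^ (e + k / 2)) := by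
  set H : ℝ × (Fin k → ℝ) → ℝ≥0∞ := indicator {p | p.1 ^ 2 + ∑ i, p.2 i ^ 2 < 1} fun p =>
    G p.1 * ENNReal.ofReal ((1 - (p.1 ^ 2 + ∑ i, p.2 i ^ 2)) ^ e) with hH
  have hHm : Measurable H :=
    Measurable.indicator (by fun_prop) (measurableSet_lt (by fun_prop) measurable_const)
  have h := (volume_preserving_piFinSuccAbove (fun _ : Fin (k + 1) => ℝ) 0).symm
  have hcons : ∀ p : ℝ × (Fin k → ℝ),
      (MeasurableEquiv.piFinSuccAbove (fun _ => ℝ) 0).symm p =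
        (Fin.cons p.1 p.2 : Fin (k + 1) → ℝ) := fun p => by
    simp [Fin.consEquiv]
  rw [← lintegral_indicator (measurableSet_sum_sq_lt (k + 1) 1),
    ← h.lintegral_comp_emb (MeasurableEquiv.measurableEmbedding _)]
  have h1 : ∀ p : ℝ × (Fin k → ℝ), indicator {x : Fin (k + 1) → ℝ | ∑ i, x i ^ 2 < 1}
      (fun x => G (x 0) * ENNReal.ofReal ((1 - ∑ i, x i ^ 2) ^ e))
      ((MeasurableEquiv.piFinSuccAbove (fun _ => ℝ) 0).symm p) = H p := by
    intro p
    rw [hcons, hH]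
    simp [indicator, Fin.sum_univ_succ]
  simp only [h1]
  rw [Measure.volume_eq_prod, lintegral_prod _ hHm.aemeasurable,
    ← lintegral_const_mul _ (by fun_prop), ← lintegral_indicator measurableSet_Ioo]
  refine lintegral_congr fun y => ?_
  by_cases hy : y ∈ Ioo (-1 : ℝ) 1
  · have hpos := one_sub_sq_pos (mem_Ioo_neg_one_one.1 hy)
    set r := √(1 - y ^ 2) with hr
    have hr0 : 0 < r := Real.sqrt_pos.2 hpos
    have hr2 : r ^ 2 = 1 - y ^ 2 := Real.sq_sqrt hpos.le
    have hsum : ∀ w : Fin k → ℝ, 1 - (y ^ 2 + ∑ i, (r • w) i ^ 2) =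
        (1 - y ^ 2) * (1 - ∑ i, w i ^ 2) := by
      intro w
      simp only [Pi.smul_apply, smul_eq_mul, mul_pow, ← Finset.mul_sum, hr2]
      ring
    -- The slice at height `y` is a ball of radius `r` in dimension `k`, with Jacobian `r ^ k`.
    have hexp : r ^ k * (1 - y ^ 2) ^ e = (1 - y ^ 2) ^ (e + k / 2) := by
      rw [hr, Real.sqrt_eq_rpow, ← Real.rpow_natCast, ← Real.rpow_mul hpos.le,
        ← Real.rpow_add hpos]
      congr 1; ring
    rw [lintegral_eq_mul_lintegral_comp_smul volume _ hr0, indicator_of_mem hy,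
      ← lintegral_indicator (measurableSet_sum_sq_lt k 1), Module.finrank_pi, Fintype.card_fin]
    rw [← lintegral_const_mul' _ _ ENNReal.ofReal_ne_top, mul_comm,
      ← lintegral_const_mul _ (Measurable.indicator (by fun_prop) (measurableSet_sum_sq_lt k 1))]
    refine lintegral_congr fun w => ?_
    have hiff : y ^ 2 + ∑ i, (r • w) i ^ 2 < 1 ↔ ∑ i, w i ^ 2 < 1 := by
      rw [← sub_pos, hsum, mul_pos_iff_of_pos_left hpos, sub_pos]
    by_cases hw : ∑ i, w i ^ 2 < 1
    · have hw' : 0 < 1 - ∑ i, w i ^ 2 := sub_pos.2 hw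
      rw [indicator_of_mem (by exact hw), hH, indicator_of_mem (by exact hiff.2 hw), hsum,
        Real.mul_rpow hpos.le hw'.le, ENNReal.ofReal_mul (by positivity), ← hexp,
        ENNReal.ofReal_mul (by positivity)]
      ring
    · rw [indicator_of_notMem (by exact hw), hH,
        indicator_of_notMem (by exact fun h => hw (hiff.1 h)), mul_zero, mul_zero]
  · rw [indicator_of_notMem hy]
    refine lintegral_eq_zero_of_ae_eq_zero (Filter.Eventually.of_forall fun z => ?_)
    refine indicator_of_notMem (fun h => hy ?_) _
    rw [mem_Ioo_neg_one_one, ← sq_lt_one_iff_abs_lt_one]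
    have h : y ^ 2 + ∑ i, z i ^ 2 < 1 := h
    have : 0 ≤ ∑ i, z i ^ 2 := by positivity
    linarith

theorem lintegral_sum_sq_lt_one_rpow {e : ℝ} (he : -1 < e) : ∀ k : ℕ,
    ∫⁻ w in {w : Fin k → ℝ | ∑ i, w i ^ 2 < 1}, ENNReal.ofReal ((1 - ∑ i, w i ^ 2) ^ e) =
      ENNReal.ofReal (Real.pi ^ ((k : ℝ) / 2) * Real.Gamma (e + 1) / Real.Gamma (e + 1 + k / 2))
  | 0 => by
    have := (Real.Gamma_pos_of_pos (show 0 < e + 1 by linarith)).ne'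
    simp [this, volume_pi]
  | k + 1 => by
    have h := lintegral_sum_sq_lt_one_eq (k := k) (G := fun _ => 1) measurable_const e
    simp only [one_mul] at h
    have hk : (0 : ℝ) ≤ k / 2 := by positivity
    have g0 := Real.Gamma_pos_of_pos (show 0 < e + 1 by linarith)
    have g1 := Real.Gamma_pos_of_pos (show 0 < e + 1 + k / 2 by linarith)
    rw [h, lintegral_sum_sq_lt_one_rpow he k, lintegral_one_sub_sq_rpow (by linarith),
      ← ENNReal.ofReal_mul (by positivity)]
    congr 1
    rw [show e + k / 2 + 1 = e + 1 + k / 2 by ring,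
      show e + k / 2 + 3 / 2 = e + 1 + ((k + 1 : ℕ) : ℝ) / 2 by push_cast; ring,
      show (((k + 1 : ℕ) : ℝ) / 2) = k / 2 + 1 / 2 by push_cast; ring,
      Real.rpow_add Real.pi_pos, Real.sqrt_eq_rpow]
    generalize Real.Gamma (e + 1 + k / 2) = x at *
    field_simp

theorem exists_linearIsometryEquiv_map_eq {E : Type*} [NormedAddCommGroup E]
    [InnerProductSpace ℝ E] {v w : E} (h : ‖v‖ = ‖w‖) : ∃ L : E ≃ₗᵢ[ℝ] E, L v = w :=
  ⟨_, Submodule.reflection_sub h⟩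

theorem setLIntegral_ball_eq {k : ℕ} {F : EuclideanSpace ℝ (Fin k) → ℝ≥0∞} :
    ∫⁻ x in Metric.ball (0 : EuclideanSpace ℝ (Fin k)) 1, F x =
      ∫⁻ x in {x : Fin k → ℝ | ∑ i, x i ^ 2 < 1}, F (WithLp.toLp 2 x) := by
  rw [← (PiLp.volume_preserving_toLp (Fin k)).setLIntegral_comp_preimage_emb
    (MeasurableEquiv.toLp 2 (Fin k → ℝ)).measurableEmbedding]
  congr 2
  ext x
  simp [EuclideanSpace.norm_eq, Real.sqrt_lt' one_pos]

/-- A linear isometry moves `s` to the first axis, so only the first marginal matters. Its exponent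
`e + (m - 1) / 2` equals `A / 2 - 1` for `A = 2e + m + 1`, as the Möbius substitution requires. -/
theorem lintegral_ball_one_sub_inner_rpow {m : ℕ} (hm : 1 ≤ m) {e : ℝ}
    {s : EuclideanSpace ℝ (Fin m)} (hs : ‖s‖ < 1) :
    ∫⁻ x in Metric.ball (0 : EuclideanSpace ℝ (Fin m)) 1,
        ENNReal.ofReal ((1 - ⟪s, x⟫) ^ (-(2 * e + m + 1))) *
          ENNReal.ofReal ((1 - ‖x‖ ^ 2) ^ e) =
      ENNReal.ofReal ((1 - ‖s‖ ^ 2) ^ (-((2 * e + m + 1) / 2))) *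
        ∫⁻ x in Metric.ball (0 : EuclideanSpace ℝ (Fin m)) 1,
          ENNReal.ofReal ((1 - ‖x‖ ^ 2) ^ e) := by
  obtain ⟨k, rfl⟩ : ∃ k, m = k + 1 := ⟨m - 1, by omega⟩
  obtain ⟨L, hL⟩ := exists_linearIsometryEquiv_map_eq
    (v := s) (w := EuclideanSpace.single (0 : Fin (k + 1)) ‖s‖) (by simp)
  have hball : L ⁻¹' Metric.ball 0 1 = Metric.ball 0 1 := by ext z; simp
  set A := 2 * e + ((k + 1 : ℕ) : ℝ) + 1 with hA
  have hrot := L.measurePreserving.setLIntegral_comp_preimage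
    (measurableSet_ball (x := (0 : EuclideanSpace ℝ (Fin (k + 1)))) (ε := 1))
    (f := fun x => ENNReal.ofReal ((1 - ‖s‖ * x 0) ^ (-A)) * ENNReal.ofReal ((1 - ‖x‖ ^ 2) ^ e))
    (by fun_prop)
  have hin : ∀ x, ⟪s, x⟫ = ‖s‖ * L x 0 := by
    intro x
    rw [← L.inner_map_map, hL, EuclideanSpace.inner_single_left]
    simp
  have hnorm : ∀ x : Fin (k + 1) → ℝ, ‖(WithLp.toLp 2 x : EuclideanSpace ℝ (Fin (k + 1)))‖ ^ 2 =
      ∑ i, x i ^ 2 := by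
    intro x
    rw [EuclideanSpace.norm_eq, Real.sq_sqrt (by positivity)]
    simp
  rw [hball] at hrot
  simp only [L.norm_map, ← hin] at hrot
  have hσ : |‖s‖| < 1 := by rwa [abs_norm]
  generalize ‖s‖ = σ at hrot hσ ⊢
  rw [hrot, setLIntegral_ball_eq, setLIntegral_ball_eq]
  simp only [hnorm]
  have h1 := lintegral_sum_sq_lt_one_eq (k := k)
    (G := fun y => ENNReal.ofReal ((1 - σ * y) ^ (-A))) (by fun_prop) e
  have h2 := lintegral_sum_sq_lt_one_eq (k := k) (G := fun _ => 1) measurable_const e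
  simp only [one_mul] at h2
  have hexp : e + k / 2 = A / 2 - 1 := by rw [hA]; push_cast; ring
  rw [hexp] at h1 h2
  rw [lintegral_one_sub_sq_mul_one_sub_rpow A hσ] at h1
  rw [h1, h2]
  ring

end BallLaw

/-! ### Means over the time lengths and over the angles. -/

section Flight

open Set
open scoped ENNReal RealInnerProductSpace

/-- The mean of a negative power of a linear form in the time lengths. -/
theorem lintegral_timeLaw_rpow {d n : ℕ} {ν t : ℝ} (ht : 0 < t) (ha : 0 < 2 * ν + d - 1)
    {x : Fin (n + 1) → ℝ} (hx : ∀ k, 0 < x k) :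
    ∫⁻ τ, ENNReal.ofReal
        (((∑ k, x k * durations t τ k) / t) ^ (-(((n : ℝ) + 1) * (2 * ν + d - 1))))
        ∂timeLaw d n ν t =
      ∏ k, ENNReal.ofReal (x k ^ (-(2 * ν + d - 1))) := by
  set a := 2 * ν + (d : ℝ) - 1 with haa
  have hA : 0 < ((n : ℝ) + 1) * a := by positivity
  have hGA := Real.Gamma_pos_of_pos hA
  have hGa := Real.Gamma_pos_of_pos ha
  have hd : ∀ k, Measurable fun τ : Fin n → ℝ => durations t τ k := fun k =>
    (measurable_pi_apply k).comp
      (measurable_durations.comp (measurable_const.prodMk measurable_id))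
  have hdens : Measurable fun τ : Fin n → ℝ => timeDensity d n ν t τ := by
    unfold timeDensity; fun_prop
  rw [timeLaw, lintegral_withDensity_eq_lintegral_mul _ (by fun_prop) (by fun_prop)]
  have h1 := lintegral_timeSimplex_prod_mul_rpow ht ha hx
  have h2 : ∀ τ ∈ timeSimplex n t, ((fun τ => ENNReal.ofReal (timeDensity d n ν t τ)) *
      fun τ => ENNReal.ofReal (((∑ k, x k * durations t τ k) / t) ^ (-(((n : ℝ) + 1) * a)))) τ =
      ENNReal.ofReal ((Real.Gamma a ^ (n + 1))⁻¹) * (ENNReal.ofReal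
        (t * Real.Gamma ((n + 1) * a)) * ENNReal.ofReal ((∏ k, durations t τ k ^ (a - 1)) *
          (∑ k, x k * durations t τ k) ^ (-((n + 1) * a)))) := by
    intro τ hτ
    have hp := durations_pos_iff.2 hτ
    have hD : 0 < ∏ k, durations t τ k ^ (a - 1) :=
      Finset.prod_pos fun k _ => Real.rpow_pos_of_pos (hp k) _
    have hS : 0 < ∑ k, x k * durations t τ k :=
      Finset.sum_pos (fun k _ => mul_pos (hx k) (hp k)) Finset.univ_nonempty
    have hexp : 2 * ν + (d : ℝ) - 2 = a - 1 := by rw [haa]; ring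
    rw [Pi.mul_apply, timeDensity, hexp, ← haa, ← ENNReal.ofReal_mul (by positivity),
      ← ENNReal.ofReal_mul (by positivity), ← ENNReal.ofReal_mul (by positivity)]
    congr 1
    rw [Real.div_rpow hS.le ht.le, Real.rpow_neg ht.le, Real.rpow_sub ht, Real.rpow_one]
    have := Real.rpow_pos_of_pos ht (((n : ℝ) + 1) * a)
    field_simp
  rw [setLIntegral_congr_fun (measurableSet_timeSimplex n t) h2,
    lintegral_const_mul' _ _ ENNReal.ofReal_ne_top, lintegral_const_mul' _ _ ENNReal.ofReal_ne_top,
    h1, ← ENNReal.ofReal_mul (by positivity), ← ENNReal.ofReal_prod_of_nonneg fun k _ =>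
      Real.rpow_nonneg (hx k).le _]
  congr 1
  rw [Finset.prod_mul_distrib, Finset.prod_const, Finset.card_univ, Fintype.card_fin,
    inv_mul_cancel_left₀ (by positivity)]

/-- The mean of a negative power of an affine form in the direction. -/
theorem lintegral_angleLaw_rpow {N : ℕ} {ν : ℝ} [IsProbabilityMeasure (angleLaw (N + 2) ν)]
    {s : Fin (N + 1) → ℝ} (hs : ∑ i, s i ^ 2 < 1) :
    ∫⁻ θ, ENNReal.ofReal ((1 - angularForm s θ) ^ (-(2 * ν + (N + 2 : ℕ) - 1)))
        ∂angleLaw (N + 2) ν =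
      ENNReal.ofReal ((1 - ∑ i, s i ^ 2) ^ (-((2 * ν + (N + 2 : ℕ) - 1) / 2))) := by
  obtain ⟨C, hC⟩ := exists_lintegral_angularForm (2 * ν) N
  set K := Real.Gamma (ν + (N + 2 : ℕ) / 2) /
    (2 * Real.pi ^ ((((N + 2 : ℕ) : ℝ) - 1) / 2) * Real.Gamma (ν + 1 / 2)) with hK
  have hW := measurable_angleWeight (N + 1) (2 * ν)
  have hdens : ∀ θ, angleDensity (N + 2) ν θ = K * angleWeight (N + 1) (2 * ν) θ := by
    intro θ
    rw [angleDensity, angleWeight]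
    congr 1
    refine Finset.prod_congr rfl fun j _ => ?_
    congr 1
    push_cast; ring
  have hW0 : ∀ θ, 0 ≤ angleWeight (N + 1) (2 * ν) θ := fun θ =>
    Finset.prod_nonneg fun j _ => Real.rpow_nonneg (abs_nonneg _) _
  have hlaw : ∀ f : ℝ → ℝ≥0∞, Measurable f → ∀ s : Fin (N + 1) → ℝ,
      ∫⁻ θ, f (angularForm s θ) ∂angleLaw (N + 2) ν = ENNReal.ofReal K * C *
        ∫⁻ y in Ioo (-1 : ℝ) 1, f (√(∑ i, s i ^ 2) * y) *
          ENNReal.ofReal ((1 - y ^ 2) ^ ((2 * ν + (N + 1 : ℕ)) / 2 - 1)) := by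
    intro f hf s
    have hm := measurable_angularForm s
    rw [mul_assoc, ← hC f hf s, ← lintegral_const_mul _ (by fun_prop)]
    simp only [angleLaw, hdens]
    rw [lintegral_withDensity_eq_lintegral_mul _ (by exact (hW.const_mul K).ennreal_ofReal)
      (by exact hf.comp hm)]
    change ∫⁻ θ in angleRange (N + 1), _ = _
    refine lintegral_congr fun θ => ?_
    rw [Pi.mul_apply, ENNReal.ofReal_mul' (hW0 θ)]
    ring
  -- Total mass one fixes the product of `K`, `C` and the beta integral, so `C` never has to be
  -- computed.
  have hone := hlaw (fun _ => 1) measurable_const 0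
  have hσ : |√(∑ i, s i ^ 2)| < 1 := by
    rw [abs_of_nonneg (Real.sqrt_nonneg _), Real.sqrt_lt' one_pos]
    simpa using hs
  have hexp : 2 * ν + ((N + 2 : ℕ) : ℝ) - 1 = 2 * ν + (N + 1 : ℕ) := by push_cast; ring
  have h1 := hlaw (fun z => ENNReal.ofReal ((1 - z) ^ (-(2 * ν + (N + 1 : ℕ))))) (by fun_prop) s
  rw [lintegral_one_sub_sq_mul_one_sub_rpow _ hσ, Real.sq_sqrt (by positivity), mul_left_comm] at h1
  simp only [one_mul, lintegral_const, measure_univ, mul_one] at hone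
  rw [hexp, h1, ← hone, mul_one]

theorem lintegral_angleLaw_rpow_of_two_le {d : ℕ} {ν : ℝ} [IsProbabilityMeasure (angleLaw d ν)]
    (hd : 2 ≤ d) {s : Fin (d - 1) → ℝ} (hs : ∑ i, s i ^ 2 < 1) :
    ∫⁻ θ, ENNReal.ofReal ((1 - angularForm s θ) ^ (-(2 * ν + d - 1))) ∂angleLaw d ν =
      ENNReal.ofReal ((1 - ∑ i, s i ^ 2) ^ (-((2 * ν + d - 1) / 2))) := by
  obtain ⟨N, rfl⟩ : ∃ N, d = N + 2 := ⟨d - 2, by omega⟩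
  exact lintegral_angleLaw_rpow hs

/-- The extension of `s` by zero. -/
def extendZero {m N : ℕ} (s : EuclideanSpace ℝ (Fin m)) (j : Fin N) : ℝ :=
  if h : j.val < m then s ⟨j.val, h⟩ else 0

theorem sum_extendZero {m N : ℕ} (hmN : m ≤ N) (s : EuclideanSpace ℝ (Fin m))
    (g : Fin N → ℝ → ℝ) (hg : ∀ j, g j 0 = 0) :
    ∑ j, g j (extendZero s j) = ∑ i, g (Fin.castLE hmN i) (s i) := by
  refine (Fintype.sum_of_injective (Fin.castLE hmN) (Fin.castLE_injective hmN) _ _ ?_ ?_).symm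
  · intro j hj
    have : ¬ j.val < m := fun h => hj ⟨⟨j.val, h⟩, rfl⟩
    rw [extendZero, dif_neg this, hg]
  · intro i
    simp [extendZero]

theorem sum_extendZero_sq {m N : ℕ} (hmN : m ≤ N) (s : EuclideanSpace ℝ (Fin m)) :
    ∑ j : Fin N, extendZero s j ^ 2 = ‖s‖ ^ 2 := by
  rw [sum_extendZero hmN s (fun _ x => x ^ 2) (by simp), EuclideanSpace.norm_eq,
    Real.sq_sqrt (by positivity)]
  simp

/-- As `m ≤ d - 1`, only coordinates ending in a cosine occur. The last one, a pure product of
sines, is never seen. -/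
theorem inner_proj_direction {m d : ℕ} (hmd : m < d) (s : EuclideanSpace ℝ (Fin m))
    (θ : Fin (d - 1) → ℝ) :
    ⟪s, proj hmd.le (direction d θ)⟫ = angularForm (extendZero s) θ := by
  have hmN : m ≤ d - 1 := by omega
  rw [angularForm, sum_extendZero hmN s (fun i x => x *
    ((∏ j : Fin (d - 1), if j.val < i.val then Real.sin (θ j) else 1) * Real.cos (θ i))) (by simp)]
  simp only [PiLp.inner_apply, proj, direction]
  refine Finset.sum_congr rfl fun i _ => ?_
  have : (Fin.castLE hmd.le i).val < d - 1 := by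
    have := i.2
    simp only [Fin.val_castLE]; omega
  rw [dif_pos this]
  simp only [RCLike.inner_apply, conj_trivial]
  rw [mul_comm]
  rfl

theorem inner_proj_position {m d n : ℕ} (hmd : m < d) (c t : ℝ) (s : EuclideanSpace ℝ (Fin m))
    (τ : Fin n → ℝ) (θ : Fin (n + 1) → Fin (d - 1) → ℝ) :
    ⟪s, proj hmd.le (position d c t τ θ)⟫ =
      c * ∑ k, durations t τ k * angularForm (extendZero s) (θ k) := by
  simp only [← inner_proj_direction hmd]
  have : proj hmd.le (position d c t τ θ) =
      c • ∑ k, durations t τ k • proj hmd.le (direction d (θ k)) := by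
    ext i
    simp [proj, position]
  rw [this, inner_smul_right, inner_sum]
  simp only [inner_smul_right]

end Flight

/-! ### The transform of the flight and the identification of its law. -/

section Law

open Set
open scoped ENNReal RealInnerProductSpace

variable {Ω : Type*} [MeasurableSpace Ω] {P : Measure Ω}
  {d m n : ℕ} {ν c t : ℝ} {τ : Ω → Fin n → ℝ} {θ : Fin (n + 1) → Ω → Fin (d - 1) → ℝ}

theorem measurable_proj_position (hmd : m < d) (c t : ℝ) :
    Measurable fun p : (Fin n → ℝ) × (Fin (n + 1) → Fin (d - 1) → ℝ) =>
      proj hmd.le (position d c t p.1 p.2) := by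
  have hd : ∀ k, Measurable fun τ : Fin n → ℝ => durations t τ k := fun k =>
    (measurable_pi_apply k).comp
      (measurable_durations.comp (measurable_const.prodMk measurable_id))
  have hdir : ∀ i : Fin d, Measurable fun θ : Fin (d - 1) → ℝ => direction d θ i := by
    intro i
    simp only [direction]
    refine Measurable.mul (Finset.measurable_fun_prod _ fun j _ => ?_) ?_
    · split_ifs <;> fun_prop
    · split_ifs <;> fun_prop
  refine (MeasurableEquiv.toLp 2 (Fin m → ℝ)).measurable.comp (measurable_pi_iff.2 fun i => ?_)
  simp only [position, PiLp.smul_apply, WithLp.ofLp_sum, Finset.sum_apply, smul_eq_mul]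
  refine Measurable.const_mul (Finset.measurable_fun_sum _ fun k _ => ?_) _
  exact ((hd k).comp measurable_fst).mul
    ((hdir _).comp ((measurable_pi_apply k).comp measurable_snd))

theorem IsFlightData.aemeasurable_pair (h : IsFlightData P d n ν t τ θ) :
    AEMeasurable (fun ω => (τ ω, fun k => θ k ω)) P :=
  h.time_law.aemeasurable.prodMk (aemeasurable_pi_lambda _ fun k => (h.angle_law k).aemeasurable)

theorem IsFlightData.aemeasurable_projectedFlight (h : IsFlightData P d n ν t τ θ) (hmd : m < d) :
    AEMeasurable (projectedFlight hmd.le c t τ θ) P := by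
  have h1 := h.aemeasurable_pair
  have h2 := measurable_proj_position (n := n) hmd c t
  have h3 := h2.comp_aemeasurable h1
  exact h3

theorem IsFlightData.map_pair [IsProbabilityMeasure P] (h : IsFlightData P d n ν t τ θ) :
    P.map (fun ω => (τ ω, fun k => θ k ω)) =
      (timeLaw d n ν t).prod (Measure.pi fun _ => angleLaw d ν) := by
  have hθ := fun k => (h.angle_law k).aemeasurable
  have hpi := h.angle_indep.map_fun_eq_pi_map hθ
  simp only [(h.angle_law _).map_eq] at hpi
  rw [(indepFun_iff_map_prod_eq_prod_map_map h.time_law.aemeasurable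
    (aemeasurable_pi_lambda _ hθ)).1 h.time_angle_indep, hpi, h.time_law.map_eq]

theorem inner_smul_projectedFlight {Ω : Type*} {τ : Ω → Fin n → ℝ}
    {θ : Fin (n + 1) → Ω → Fin (d - 1) → ℝ} (hmd : m < d) (hc : 0 < c)
    (s : EuclideanSpace ℝ (Fin m)) (ω : Ω) :
    ⟪s, (c * t)⁻¹ • projectedFlight hmd.le c t τ θ ω⟫ =
      (∑ k, durations t (τ ω) k * angularForm (extendZero s) (θ k ω)) / t := by
  rw [inner_smul_right, projectedFlight, inner_proj_position hmd]
  field_simp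

theorem abs_angularForm_le {N : ℕ} (hmN : m ≤ N) (s : EuclideanSpace ℝ (Fin m))
    (θ : Fin N → ℝ) : |angularForm (extendZero s) θ| ≤ ‖s‖ := by
  have h := angularForm_sq_le (extendZero s) θ
  rw [sum_extendZero_sq hmN] at h
  exact abs_le_of_sq_le_sq h (norm_nonneg s)

/-- The flight stays in the closed ball of radius `c t`. -/
theorem IsFlightData.ae_norm_le (h : IsFlightData P d n ν t τ θ) (hmd : m < d) (hc : 0 < c)
    (ht : 0 < t) : ∀ᵐ ω ∂P, ‖(c * t)⁻¹ • projectedFlight hmd.le c t τ θ ω‖ ≤ 1 := by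
  have h1 : ∀ᵐ ω ∂P, τ ω ∈ timeSimplex n t := by
    refine ae_of_ae_map h.time_law.aemeasurable ?_
    rw [h.time_law.map_eq]
    exact (withDensity_absolutelyContinuous _ _).ae_le
      (ae_restrict_mem (measurableSet_timeSimplex n t))
  filter_upwards [h1] with ω hω
  have hp := durations_pos_iff.2 hω
  set y := (c * t)⁻¹ • projectedFlight hmd.le c t τ θ ω with hy
  -- The position is tested against itself: `⟪y, y⟫` is an average of inner products of `y` with
  -- projected directions, each at most `‖y‖`.
  have hle : ‖y‖ ^ 2 ≤ ‖y‖ := by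
    rw [← real_inner_self_eq_norm_sq]
    nth_rewrite 2 [hy]
    rw [inner_smul_projectedFlight hmd hc, div_le_iff₀ ht, mul_comm]
    calc ∑ k, durations t (τ ω) k * angularForm (extendZero y) (θ k ω)
        ≤ ∑ k, durations t (τ ω) k * ‖y‖ := Finset.sum_le_sum fun k _ =>
          mul_le_mul_of_nonneg_left
            ((le_abs_self _).trans (abs_angularForm_le (by omega) y _)) (hp k).le
      _ = t * ‖y‖ := by rw [← Finset.sum_mul, sum_durations]
  by_contra hlt
  nlinarith [norm_nonneg y]

/-- Averaging over the times with the angles fixed factorizes the integrand; each of the `n + 1`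
independent directions then contributes `(1 - ‖s‖²) ^ (-a / 2)`. -/
theorem IsFlightData.lintegral_rpow [IsProbabilityMeasure P] (h : IsFlightData P d n ν t τ θ) (hd : 2 ≤ d) (hmd : m < d)
    (hν : 0 ≤ ν) (hc : 0 < c) (ht : 0 < t) {s : EuclideanSpace ℝ (Fin m)} (hs : ‖s‖ < 1) :
    ∫⁻ ω, ENNReal.ofReal ((1 - ⟪s, (c * t)⁻¹ • projectedFlight hmd.le c t τ θ ω⟫) ^
        (-(((n : ℝ) + 1) * (2 * ν + d - 1)))) ∂P =
      ENNReal.ofReal ((1 - ‖s‖ ^ 2) ^ (-(((n : ℝ) + 1) * (2 * ν + d - 1) / 2))) := by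
  have hmN : m ≤ d - 1 := by omega
  have : IsProbabilityMeasure (angleLaw d ν) :=
    (h.angle_law 0).isProbabilityMeasure_iff.1 inferInstance
  have : IsProbabilityMeasure (timeLaw d n ν t) :=
    h.time_law.isProbabilityMeasure_iff.1 inferInstance
  set a := 2 * ν + d - 1 with haa
  have ha : 0 < a := by
    have : (2 : ℝ) ≤ d := by exact_mod_cast hd
    linarith
  set q : (Fin (d - 1) → ℝ) → ℝ := angularForm (extendZero s) with hq
  have hqm : Measurable q := measurable_angularForm _
  have hq1 : ∀ θ, 0 < 1 - q θ := fun θ => by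
    have := (le_abs_self _).trans (abs_angularForm_le hmN s θ)
    linarith
  set Φ : (Fin n → ℝ) × (Fin (n + 1) → Fin (d - 1) → ℝ) → ℝ≥0∞ := fun p => ENNReal.ofReal
    (((∑ k, (1 - q (p.2 k)) * durations t p.1 k) / t) ^ (-(((n : ℝ) + 1) * a))) with hΦ
  have hdm : ∀ k, Measurable fun p : (Fin n → ℝ) × (Fin (n + 1) → Fin (d - 1) → ℝ) =>
      durations t p.1 k := fun k => (measurable_pi_apply k).comp
    (measurable_durations.comp (measurable_const.prodMk measurable_fst))
  have hΦm : Measurable Φ := by fun_prop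
  have h1 : ∀ ω, ENNReal.ofReal ((1 - ⟪s, (c * t)⁻¹ • projectedFlight hmd.le c t τ θ ω⟫) ^
      (-(((n : ℝ) + 1) * a))) = Φ (τ ω, fun k => θ k ω) := by
    intro ω
    rw [inner_smul_projectedFlight hmd hc, hΦ]
    congr 2
    -- Because the durations sum to `t`, the constant `1` can be absorbed into the average, giving
    -- the linear form with coefficients `1 - q (θ k)`.
    rw [eq_div_iff ht.ne', sub_mul, div_mul_cancel₀ _ ht.ne', one_mul]
    simp only [sub_mul, one_mul, Finset.sum_sub_distrib, sum_durations]
    congr 1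
    exact Finset.sum_congr rfl fun k _ => mul_comm _ _
  simp only [h1]
  have h2 := lintegral_map' (μ := P) (f := Φ) hΦm.aemeasurable h.aemeasurable_pair
  rw [← h2, h.map_pair, lintegral_prod_symm _ hΦm.aemeasurable]
  have h3 : ∀ θ' : Fin (n + 1) → Fin (d - 1) → ℝ,
      ∫⁻ τ', Φ (τ', θ') ∂timeLaw d n ν t =
        ∏ k, ENNReal.ofReal ((1 - q (θ' k)) ^ (-a)) := by
    intro θ'
    rw [← lintegral_timeLaw_rpow ht ha fun k => hq1 (θ' k)]
  have hsum : ∑ j : Fin (d - 1), extendZero s j ^ 2 = ‖s‖ ^ 2 := sum_extendZero_sq hmN s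
  have hlt : ‖s‖ ^ 2 < 1 := (sq_lt_one_iff₀ (norm_nonneg s)).2 hs
  have h4 : ∫⁻ θ', ENNReal.ofReal ((1 - q θ') ^ (-a)) ∂angleLaw d ν =
      ENNReal.ofReal ((1 - ‖s‖ ^ 2) ^ (-(a / 2))) := by
    rw [← hsum]
    exact lintegral_angleLaw_rpow_of_two_le hd (by rw [hsum]; exact hlt)
  have h5 := lintegral_pi_prod_eq_prod_lintegral (fun _ : Fin (n + 1) => angleLaw d ν)
    (f := fun _ θ' => ENNReal.ofReal ((1 - q θ') ^ (-a))) (fun k => by fun_prop)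
  refine (lintegral_congr h3).trans (h5.trans ?_)
  simp only [h4]
  have hpos : 0 < 1 - ‖s‖ ^ 2 := by linarith
  rw [Finset.prod_const, Finset.card_univ, Fintype.card_fin, ← ENNReal.ofReal_pow (by positivity),
    ← Real.rpow_natCast, ← Real.rpow_mul hpos.le]
  congr 2
  push_cast; ring

/-- The rotationally invariant law on the ball of radius `R` with density proportional to
`(R² - |x|²)^(μ - m/2)`. -/
def ballLaw (m : ℕ) (μ R : ℝ) : Measure (EuclideanSpace ℝ (Fin m)) :=
  (volume.restrict (Metric.ball (0 : EuclideanSpace ℝ (Fin m)) R)).withDensity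
    fun x => ENNReal.ofReal
      (Real.Gamma (μ + 1) / (Real.Gamma (μ + 1 - m / 2) * Real.pi ^ ((m : ℝ) / 2) * R ^ (2 * μ)) *
        (R ^ 2 - ‖x‖ ^ 2) ^ (μ - m / 2))

theorem lintegral_ballLaw (m : ℕ) (μ R : ℝ) {f : EuclideanSpace ℝ (Fin m) → ℝ≥0∞}
    (hf : Measurable f) :
    ∫⁻ x, f x ∂ballLaw m μ R = ∫⁻ x in Metric.ball (0 : EuclideanSpace ℝ (Fin m)) R,
      ENNReal.ofReal (Real.Gamma (μ + 1) /
        (Real.Gamma (μ + 1 - m / 2) * Real.pi ^ ((m : ℝ) / 2) * R ^ (2 * μ)) *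
          (R ^ 2 - ‖x‖ ^ 2) ^ (μ - m / 2)) * f x := by
  rw [ballLaw, lintegral_withDensity_eq_lintegral_mul _ (by fun_prop) hf]
  rfl

theorem map_ballLaw (m : ℕ) (μ R : ℝ)
    (L : EuclideanSpace ℝ (Fin m) ≃ₗᵢ[ℝ] EuclideanSpace ℝ (Fin m)) :
    (ballLaw m μ R).map L = ballLaw m μ R := by
  have hL : Measurable L := L.continuous.measurable
  refine Measure.ext_of_lintegral _ fun f hf => ?_
  have hball : L ⁻¹' Metric.ball 0 R = Metric.ball 0 R := by ext z; simp
  rw [lintegral_map hf hL, lintegral_ballLaw m μ R (f := fun x => f (L x)) (hf.comp hL), lintegral_ballLaw m μ R hf,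
    ← L.measurePreserving.setLIntegral_comp_preimage (measurableSet_ball (x := 0) (ε := R))
      (f := fun x => ENNReal.ofReal (Real.Gamma (μ + 1) /
        (Real.Gamma (μ + 1 - m / 2) * Real.pi ^ ((m : ℝ) / 2) * R ^ (2 * μ)) *
          (R ^ 2 - ‖x‖ ^ 2) ^ (μ - m / 2)) * f x) (by fun_prop), hball]
  simp only [L.norm_map]

theorem map_smul_ballLaw (m : ℕ) (μ : ℝ) {R : ℝ} (hR : 0 < R) :
    (ballLaw m μ 1).map (fun x => R • x) = ballLaw m μ R := by
  refine Measure.ext_of_lintegral _ fun f hf => ?_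
  rw [lintegral_map hf (by fun_prop), lintegral_ballLaw m μ 1 (by fun_prop),
    lintegral_ballLaw m μ R hf, ← lintegral_indicator measurableSet_ball,
    ← lintegral_indicator measurableSet_ball, lintegral_eq_mul_lintegral_comp_smul volume (indicator (Metric.ball 0 R) _) hR,
    ← lintegral_const_mul' _ _ ENNReal.ofReal_ne_top]
  refine lintegral_congr fun x => ?_
  have hiff : R • x ∈ Metric.ball (0 : EuclideanSpace ℝ (Fin m)) R ↔ x ∈ Metric.ball 0 1 := by
    rw [mem_ball_zero_iff, mem_ball_zero_iff, norm_smul, Real.norm_of_nonneg hR.le]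
    exact mul_lt_iff_lt_one_right hR
  by_cases hx : x ∈ Metric.ball (0 : EuclideanSpace ℝ (Fin m)) 1
  · rw [indicator_of_mem hx, indicator_of_mem (hiff.2 hx), ← mul_assoc,
      ← ENNReal.ofReal_mul (by positivity)]
    congr 2
    have hx1 : 0 < 1 - ‖x‖ ^ 2 := by
      have := mem_ball_zero_iff.1 hx
      nlinarith [norm_nonneg x]
    rw [norm_smul, Real.norm_of_nonneg hR.le, finrank_euclideanSpace_fin,
      show R ^ 2 - (R * ‖x‖) ^ 2 = R ^ 2 * (1 - ‖x‖ ^ 2) by ring,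
      Real.mul_rpow (by positivity) hx1.le, one_pow, Real.one_rpow, mul_one]
    -- The normalizing power of `R` combines the Jacobian of the dilation with the homogeneity of
    -- the weight.
    have e : R ^ (2 * μ) = R ^ m * (R ^ 2) ^ (μ - m / 2) := by
      rw [← Real.rpow_natCast R 2, ← Real.rpow_natCast R m, ← Real.rpow_mul hR.le,
        ← Real.rpow_add hR]
      congr 1; push_cast; ring
    have h1 : 0 < R ^ m := by positivity
    have h2 : 0 < (R ^ 2) ^ (μ - m / 2) := by positivity
    rw [e]
    field_simp
  · rw [indicator_of_notMem hx, indicator_of_notMem (fun h => hx (hiff.1 h)), mul_zero]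

theorem lintegral_ballLaw_rpow (hm : 1 ≤ m) {μ : ℝ} (hμ : (m : ℝ) / 2 - 1 < μ)
    {s : EuclideanSpace ℝ (Fin m)} (hs : ‖s‖ < 1) :
    ∫⁻ x, ENNReal.ofReal ((1 - ⟪s, x⟫) ^ (-(2 * μ + 1))) ∂ballLaw m μ 1 =
      ENNReal.ofReal ((1 - ‖s‖ ^ 2) ^ (-((2 * μ + 1) / 2))) := by
  have hμ0 : 0 < μ + 1 := by
    have : (0 : ℝ) ≤ m / 2 := by positivity
    linarith
  have g1 := Real.Gamma_pos_of_pos hμ0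
  have g2 := Real.Gamma_pos_of_pos (show 0 < μ + 1 - m / 2 by linarith)
  have hmass : ENNReal.ofReal (Real.Gamma (μ + 1) /
      (Real.Gamma (μ + 1 - m / 2) * Real.pi ^ ((m : ℝ) / 2))) *
      ∫⁻ x in Metric.ball (0 : EuclideanSpace ℝ (Fin m)) 1,
        ENNReal.ofReal ((1 - ‖x‖ ^ 2) ^ (μ - m / 2)) = 1 := by
    have hnorm : ∀ x : Fin m → ℝ, ‖(WithLp.toLp 2 x : EuclideanSpace ℝ (Fin m))‖ ^ 2 =
        ∑ i, x i ^ 2 := by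
      intro x
      rw [EuclideanSpace.norm_eq, Real.sq_sqrt (by positivity)]
      simp
    rw [setLIntegral_ball_eq]
    simp only [hnorm]
    rw [lintegral_sum_sq_lt_one_rpow (by linarith), ← ENNReal.ofReal_mul (by positivity),
      ← ENNReal.ofReal_one]
    congr 1
    rw [show μ - m / 2 + 1 = μ + 1 - m / 2 by ring,
      show μ + 1 - (m : ℝ) / 2 + m / 2 = μ + 1 by ring]
    have : 0 < Real.pi ^ ((m : ℝ) / 2) := by positivity
    generalize Real.Gamma (μ + 1 - m / 2) = x at *
    field_simp
  have h := lintegral_ball_one_sub_inner_rpow hm (e := μ - m / 2) hs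
  rw [show 2 * (μ - (m : ℝ) / 2) + m + 1 = 2 * μ + 1 by ring] at h
  have hball : ∀ x : EuclideanSpace ℝ (Fin m), ENNReal.ofReal (Real.Gamma (μ + 1) /
        (Real.Gamma (μ + 1 - m / 2) * Real.pi ^ ((m : ℝ) / 2) * 1 ^ (2 * μ)) *
          (1 ^ 2 - ‖x‖ ^ 2) ^ (μ - m / 2)) * ENNReal.ofReal ((1 - ⟪s, x⟫) ^ (-(2 * μ + 1))) =
      ENNReal.ofReal (Real.Gamma (μ + 1) /
        (Real.Gamma (μ + 1 - m / 2) * Real.pi ^ ((m : ℝ) / 2))) *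
        (ENNReal.ofReal ((1 - ⟪s, x⟫) ^ (-(2 * μ + 1))) *
          ENNReal.ofReal ((1 - ‖x‖ ^ 2) ^ (μ - m / 2))) := by
    intro x
    rw [one_pow, Real.one_rpow, mul_one, ENNReal.ofReal_mul (by positivity)]
    ring
  rw [lintegral_ballLaw m μ 1 (by fun_prop)]
  simp only [hball]
  rw [lintegral_const_mul' _ _ ENNReal.ofReal_ne_top, h, mul_left_comm, hmass, mul_one]

theorem isProbabilityMeasure_ballLaw (hm : 1 ≤ m) {μ : ℝ} (hμ : (m : ℝ) / 2 - 1 < μ) :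
    IsProbabilityMeasure (ballLaw m μ 1) := by
  have h := lintegral_ballLaw_rpow hm hμ (s := 0) (by simp)
  simp only [inner_zero_left, norm_zero, sub_zero, Real.one_rpow, ENNReal.ofReal_one,
    lintegral_one, ne_eq, OfNat.ofNat_ne_zero, not_false_eq_true, zero_pow] at h
  exact ⟨h⟩

theorem ae_ballLaw_norm_le (m : ℕ) (μ R : ℝ) : ∀ᵐ x ∂ballLaw m μ R, ‖x‖ ≤ R := by
  refine (withDensity_absolutelyContinuous _ _).ae_le ?_
  filter_upwards [ae_restrict_mem measurableSet_ball] with x hx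
  exact (mem_ball_zero_iff.1 hx).le

theorem IsFlightData.hasLaw_projectedFlight [IsProbabilityMeasure P] (h : IsFlightData P d n ν t τ θ) (hd : 2 ≤ d)
    (hm : 1 ≤ m) (hmd : m < d) (hν : 0 ≤ ν) (hc : 0 < c) (ht : 0 < t) :
    HasLaw (projectedFlight hmd.le c t τ θ)
      (ballLaw m (((n : ℝ) + 1) * (2 * ν + d - 1) / 2 - 1 / 2) (c * t)) P := by
  set A := ((n : ℝ) + 1) * (2 * ν + d - 1) with hA
  have hR : 0 < c * t := mul_pos hc ht
  have hX := h.aemeasurable_projectedFlight (c := c) hmd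
  have hY : AEMeasurable (fun ω => (c * t)⁻¹ • projectedFlight hmd.le c t τ θ ω) P :=
    hX.const_smul (c * t)⁻¹
  -- From `m ≤ d - 1 ≤ A`, the weight exponent `μ - m / 2 = (A - 1 - m) / 2` is at least `-1 / 2`,
  -- so the ball weight is integrable.
  have hmA : (m : ℝ) ≤ A := by
    have h1 : (m : ℝ) ≤ d - 1 := by
      have : ((m + 1 : ℕ) : ℝ) ≤ d := Nat.cast_le.2 hmd
      push_cast at this; linarith
    have h2 : (0 : ℝ) ≤ n := n.cast_nonneg
    have h3 : (0 : ℝ) ≤ m := m.cast_nonneg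
    rw [hA]
    nlinarith
  have hm0 : (1 : ℝ) ≤ m := by exact_mod_cast hm
  have hμ : (m : ℝ) / 2 - 1 < A / 2 - 1 / 2 := by linarith
  have := isProbabilityMeasure_ballLaw hm hμ
  have : IsProbabilityMeasure (P.map fun ω => (c * t)⁻¹ • projectedFlight hmd.le c t τ θ ω) :=
    Measure.isProbabilityMeasure_map hY
  have key : P.map (fun ω => (c * t)⁻¹ • projectedFlight hmd.le c t τ θ ω) =
      ballLaw m (A / 2 - 1 / 2) 1 := by
    refine ext_of_lintegral_one_sub_inner_rpow (A := A) ?_ (ae_ballLaw_norm_le m _ 1)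
      (by linarith) fun s hs => ?_
    · rw [ae_map_iff hY (measurableSet_le (by fun_prop) measurable_const)]
      exact h.ae_norm_le hmd hc ht
    · have e := lintegral_ballLaw_rpow hm hμ hs
      rw [show 2 * (A / 2 - 1 / 2) + 1 = A by ring] at e
      rw [e, lintegral_map' (Measurable.aemeasurable (by fun_prop)) hY]
      exact h.lintegral_rpow hd hmd hν hc ht hs
  refine ⟨hX, ?_⟩
  rw [← map_smul_ballLaw m _ hR, ← key, AEMeasurable.map_map_of_aemeasurable (by fun_prop) hY]
  congr 1
  ext1 ω
  exact (smul_inv_smul₀ hR.ne' _).symm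

end Law

end RandomFlight

end

theorem theorem2 {Ω : Type*} [MeasurableSpace Ω] (P : Measure Ω) [IsProbabilityMeasure P]
    (d m n : ℕ) (hd : 2 ≤ d) (hm : 1 ≤ m) (hmd : m < d) (hn : 1 ≤ n)
    (ν c t : ℝ) (hν : 0 ≤ ν) (hc : 0 < c) (ht : 0 < t)
    (τ : Ω → Fin n → ℝ) (θ : Fin (n + 1) → Ω → Fin (d - 1) → ℝ)
    (hflight : RandomFlight.IsFlightData P d n ν t τ θ)
    (μ : ℝ) (hμ : μ = ((n : ℝ) + 1) * (2 * ν + d - 1) / 2 - 1 / 2) :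
    -- the law is carried by the open ball of radius `c t` and has the stated density there
    HasLaw (RandomFlight.projectedFlight hmd.le c t τ θ)
      ((volume.restrict (Metric.ball (0 : EuclideanSpace ℝ (Fin m)) (c * t))).withDensity
        fun x => ENNReal.ofReal
          (Real.Gamma (μ + 1) /
              (Real.Gamma (μ + 1 - m / 2) * Real.pi ^ ((m : ℝ) / 2) * (c * t) ^ (2 * μ)) *
            (c ^ 2 * t ^ 2 - ‖x‖ ^ 2) ^ (μ - m / 2))) P ∧
    -- the law is isotropic: it is invariant under every linear isometry of `ℝ^m`
    ∀ L : EuclideanSpace ℝ (Fin m) ≃ₗᵢ[ℝ] EuclideanSpace ℝ (Fin m),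
      IdentDistrib (fun ω => L (RandomFlight.projectedFlight hmd.le c t τ θ ω))
        (RandomFlight.projectedFlight hmd.le c t τ θ) P P := by
  have h := hflight.hasLaw_projectedFlight hd hm hmd hν hc ht
  rw [← hμ] at h
  refine ⟨by simpa only [RandomFlight.ballLaw, mul_pow] using h, fun L => ?_⟩
  have hL : AEMeasurable L (P.map (RandomFlight.projectedFlight hmd.le c t τ θ)) :=
    L.continuous.measurable.aemeasurable
  refine ⟨hL.comp_aemeasurable h.aemeasurable, h.aemeasurable, ?_⟩
  have := AEMeasurable.map_map_of_aemeasurable hL h.aemeasurable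
  rw [h.map_eq, RandomFlight.map_ballLaw] at this
  rw [h.map_eq, this]
  rfl
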